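/- For a bounded domain $D\subset\mathbb C^n$ and $z\in D$, the squeezing function is $$s_D(z)=\sup_f\,\sup\{r : B^n(0,r)\subset f(D)\},$$ where $f$ runs over all open holomorphic embeddings $f:D\to B^n$ into the unit ball $B^n=B^n(0,1)$ with $f(z)=0$. A bounded domain $D$ is called homogeneous regular if $s_D\ge c$ on $D$ for some constant $c>0$. Let $\Omega$ be a classical bounded symmetric domain, with generic norm $N(Z,Z)$, that is, one of - $D_I(r,s)$, $1\le r\le s$: the complex $r\times s$ matrices $Z$ with $I-Z\bar Z^t>0$; $N(Z,Z)=\det(I-Z\bar Z^t)$; - $D_{II}(p)$, $p\ge 1$: the symmetric complex matrices $Z$ of order $p$ with $I-Z\bar Z^t>0$; $N(Z,Z)=\det(I-Z\bar Z^t)$; - $D_{III}(q)$, $q\ge 1$: the skew-symmetric complex matrices $Z$ of order $q$ with $I-Z\bar Z^t>0$; $N(Z,Z)=\det(I+Z\bar Z)=\det(I-Z\bar Z^t)$; - $D_{IV}(n)$, $n\ge 1$: the row vectors $Z\in\mathbb C^n$ with $1+|ZZ^t|^2-2Z\bar Z^t>0$ and $1-|ZZ^t|>0$; $N(Z,Z)=1+|ZZ^t|^2-2Z\bar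 Z^t$. The spaces of matrices are regarded as complex Euclidean spaces of the corresponding dimension. Let $m\ge 1$ be an integer, let $k>0$ be a real number, and let $$\hat\Omega_k=\{(Z,W)\in\Omega\times\mathbb C^m : \|W\|^2<N(Z,Z)^k\}$$ be the associated Cartan–Hartogs domain, where $\|W\|$ is the standard Hermitian norm. Then: 1. for every $P_0=(Z_0,W_0)\in\partial\hat\Omega_k$ with $W_0\ne 0$, $\lim_{P\to P_0}s_{\hat\Omega_k}(P)=1$, where $P$ ranges over $\hat\Omega_k$; 2. $\hat\Omega_k$ is homogeneous regular (in particular, it is a bounded domain). -/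

import Mathlib

open Set Filter Topology
open scoped Matrix ComplexOrder

attribute [local instance] Matrix.frobeniusNormedAddCommGroup Matrix.frobeniusNormedSpace

section Squeezing

variable {E : Type*} [NormedAddCommGroup E] [NormedSpace ℂ E]

/-- `f` is an open holomorphic embedding of `D`: holomorphic on `D`, and a homeomorphism of `D`
onto an open set. -/
def IsOpenHolomorphicEmbedding {F : Type*} [NormedAddCommGroup F] [NormedSpace ℂ F]
    (D : Set E) (f : E → F) : Prop :=
  DifferentiableOn ℂ f D ∧ IsOpenEmbedding (D.domRestrict f)

/-- `s_D(z, f) = sup {r | B(0, r) ⊆ f(D)}`, where `f` takes its values in `ℂⁿ` with the standard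
Hermitian norm, and `n` is the complex dimension of the space that contains `D`. -/
noncomputable def squeezingAlong (D : Set E)
    (f : E → EuclideanSpace ℂ (Fin (Module.finrank ℂ E))) : ℝ :=
  sSup {r : ℝ | Metric.ball 0 r ⊆ f '' D}

/-- The squeezing function `s_D(z)`: the supremum of `s_D(z, f)` over all open holomorphic
embeddings `f` of `D` into the unit ball with `f z = 0`. -/
noncomputable def squeezingFunction (D : Set E) (z : E) : ℝ :=
  sSup {x : ℝ | ∃ f : E → EuclideanSpace ℂ (Fin (Module.finrank ℂ E)),
    IsOpenHolomorphicEmbedding D f ∧ MapsTo f D (Metric.ball 0 1) ∧ f z = 0 ∧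
      x = squeezingAlong D f}

/-- A homogeneous regular domain: a bounded domain whose squeezing function is bounded below by a
positive constant. -/
structure IsHomogeneousRegular (D : Set E) : Prop where
  isOpen : IsOpen D
  isConnected : IsConnected D
  isBounded : Bornology.IsBounded D
  bound : ∃ c : ℝ, 0 < c ∧ ∀ z ∈ D, c ≤ squeezingFunction D z

end Squeezing

/-- The four series of classical bounded symmetric domains, with their size parameters. -/
inductive ClassicalSeries : Type
  | I (r s : ℕ) (hr : 1 ≤ r) (hrs : r ≤ s)
  | II (p : ℕ) (hp : 1 ≤ p)
  | III (q : ℕ) (hq : 1 ≤ q)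
  | IV (n : ℕ) (hn : 1 ≤ n)

namespace ClassicalSeries

def rows : ClassicalSeries → ℕ
  | I r _ _ _ => r
  | II p _ => p
  | III q _ => q
  | IV _ _ => 1

def cols : ClassicalSeries → ℕ
  | I _ s _ _ => s
  | II p _ => p
  | III q _ => q
  | IV n _ => n

/-- The space of symmetric complex matrices of order `p`. -/
def symmetricMatrices (p : ℕ) : Submodule ℂ (Matrix (Fin p) (Fin p) ℂ) where
  carrier := {Z | Zᵀ = Z}
  add_mem' {A B} hA hB := by
    simp only [mem_ofPred_eq] at *
    rw [Matrix.transpose_add, hA, hB]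
  zero_mem' := Matrix.transpose_zero
  smul_mem' c A hA := by
    simp only [mem_ofPred_eq] at *
    rw [Matrix.transpose_smul, hA]

/-- The space of skew-symmetric complex matrices of order `q`. -/
def skewSymmetricMatrices (q : ℕ) : Submodule ℂ (Matrix (Fin q) (Fin q) ℂ) where
  carrier := {Z | Zᵀ = -Z}
  add_mem' {A B} hA hB := by
    simp only [mem_ofPred_eq] at *
    rw [Matrix.transpose_add, hA, hB, neg_add]
  zero_mem' := by simp
  smul_mem' c A hA := by
    simp only [mem_ofPred_eq] at *
    rw [Matrix.transpose_smul, hA, smul_neg]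

/-- The complex vector space in which the domain lies: all `r × s` matrices, the symmetric
matrices, the skew-symmetric matrices, and `ℂⁿ` (as row vectors) respectively. -/
def space : (T : ClassicalSeries) → Submodule ℂ (Matrix (Fin T.rows) (Fin T.cols) ℂ)
  | I _ _ _ _ => ⊤
  | II p _ => symmetricMatrices p
  | III q _ => skewSymmetricMatrices q
  | IV _ _ => ⊤

/-- `I - Z Z̄ᵗ`. -/
noncomputable def hermitianDefect {a b : ℕ} (Z : Matrix (Fin a) (Fin b) ℂ) :
    Matrix (Fin a) (Fin a) ℂ :=
  1 - Z * Zᴴ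

/-- For a row vector `Z`, the complex number `Z Zᵗ`. -/
noncomputable def rowSquare {n : ℕ} (Z : Matrix (Fin 1) (Fin n) ℂ) : ℂ :=
  ∑ j, Z 0 j ^ 2

/-- For a row vector `Z`, the real number `1 + |Z Zᵗ|² - 2 Z Z̄ᵗ`. -/
noncomputable def rowNorm {n : ℕ} (Z : Matrix (Fin 1) (Fin n) ℂ) : ℝ :=
  1 + ‖rowSquare Z‖ ^ 2 - 2 * ∑ j, ‖Z 0 j‖ ^ 2

/-- The classical bounded symmetric domain. -/
def domain : (T : ClassicalSeries) → Set T.space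
  | I _ _ _ _ => {Z | (hermitianDefect Z.1).PosDef}
  | II _ _ => {Z | (hermitianDefect Z.1).PosDef}
  | III _ _ => {Z | (hermitianDefect Z.1).PosDef}
  | IV n _ => {Z | 0 < rowNorm (n := n) Z.1 ∧ 0 < 1 - ‖rowSquare (n := n) Z.1‖}

/-- The generic norm `N(Z, Z)`. The determinants are real, because the matrices are Hermitian.
In the skew-symmetric case `det (I - Z Z̄ᵗ) = det (I + Z Z̄)`. -/
noncomputable def genericNorm : (T : ClassicalSeries) → T.space → ℝ
  | I _ _ _ _, Z => (hermitianDefect Z.1).det.re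
  | II _ _, Z => (hermitianDefect Z.1).det.re
  | III _ _, Z => (hermitianDefect Z.1).det.re
  | IV n _, Z => rowNorm (n := n) Z.1

end ClassicalSeries

/-- The Cartan–Hartogs domain `{(Z, W) ∈ Ω × ℂᵐ | ‖W‖² < N(Z, Z)ᵏ}` over the classical bounded
symmetric domain `Ω` given by `T`. -/
def cartanHartogs (T : ClassicalSeries) (m : ℕ) (k : ℝ) :
    Set (T.space × EuclideanSpace ℂ (Fin m)) :=
  {P | P.1 ∈ T.domain ∧ ‖P.2‖ ^ 2 < T.genericNorm P.1 ^ k}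

/-! The argument uses little about `Ω`, collected in `HomogeneousBase`: automorphisms act
transitively, each multiplies `N` by the modulus of a zero-free holomorphic function, and `1 - ‖ℓ
Z‖² ≤ N Z ≤ exp (-‖ℓ Z‖²)` in suitable Euclidean coordinates. An automorphism of `Ω` lifts to the
Hartogs domain when `W` is multiplied by a holomorphic power of that function
(`exists_equiv_hartogs`). So every point moves into the fibre over `0`, and the ratio `‖W‖² / N(Z)ᵏ`
is invariant.

After the rescaling `√k • ℓ Z`, the two bounds on `N` give contact with the unit sphere along the
fibre over `0`: with `a = |⟨e, v⟩|`, the deviation of `‖v‖²` from `1` on the boundary is `O((1 -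
a)²)` (`exists_osculation`). The ball automorphism taking `w e` to `0` divides `1 - ‖v‖²` by `|1 -
w⟨e, v⟩|² ≥ (1 - a)²` and multiplies it by `1 - w²`. The error therefore becomes `O(1 - w²)`, and
the image of the domain is squeezed between balls of radii `1 - ε` and `1 + ε`
(`ballMap_image_between`). Hence the squeezing function tends to `1` as the ratio tends to `1`,
which is what happens at a boundary point with `W₀ ≠ 0`. Where the ratio stays below `1 - τ`, the
moved points lie in a compact part of the fibre, which gives a uniform positive lower bound.

It remains to check the hypotheses for the four series. The matrix balls use Möbius maps `F (1 - Z
Aᴴ)⁻¹ (Z - A) K⁻¹` and Hua's identity `defect_identity`; for symmetric and skew matrices, `K` is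
chosen so that the map commutes with transposition up to sign. For the Lie ball, `Z` with `s = Z Zᵗ`
is lifted to the triple `(Z, (1 + s)/2, (1 - s)/2)`, on which `Z Zᵗ - y₀² + y₁²` vanishes and `‖Z‖²
- |y₀|² - |y₁|²` equals `-N/2`. Real hyperbolic rotations of one direction of `Z` against `y₀`
preserve both forms, and rescaling to `y₀ + y₁ = 1` gives the automorphisms `lieBoost`. -/

/-! ### Biholomorphic maps between sets -/

/-- `f` maps `D` holomorphically and bijectively onto `D'`, with the continuous inverse `g`. -/
structure HolomorphicEquivOn {E F : Type*} [NormedAddCommGroup E] [NormedSpace ℂ E]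
    [NormedAddCommGroup F] [NormedSpace ℂ F] (f : E → F) (g : F → E) (D : Set E) (D' : Set F) :
    Prop where
  differentiableOn : DifferentiableOn ℂ f D
  continuousOn : ContinuousOn g D'
  mapsTo : MapsTo f D D'
  mapsTo_inv : MapsTo g D' D
  leftInvOn : LeftInvOn g f D
  rightInvOn : LeftInvOn f g D'

namespace HolomorphicEquivOn

variable {E F G : Type*} [NormedAddCommGroup E] [NormedSpace ℂ E]
  [NormedAddCommGroup F] [NormedSpace ℂ F] [NormedAddCommGroup G] [NormedSpace ℂ G]
  {f : E → F} {g : F → E} {D : Set E} {D' : Set F}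

theorem refl (D : Set E) : HolomorphicEquivOn id id D D :=
  ⟨differentiableOn_id, continuousOn_id, mapsTo_id _, mapsTo_id _, fun _ _ => rfl, fun _ _ => rfl⟩

theorem trans {f' : F → G} {g' : G → F} {D'' : Set G} (h : HolomorphicEquivOn f g D D')
    (h' : HolomorphicEquivOn f' g' D' D'') :
    HolomorphicEquivOn (f' ∘ f) (g ∘ g') D D'' where
  differentiableOn := h'.differentiableOn.comp h.differentiableOn h.mapsTo
  continuousOn := h.continuousOn.comp h'.continuousOn h'.mapsTo_inv
  mapsTo := h'.mapsTo.comp h.mapsTo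
  mapsTo_inv := h.mapsTo_inv.comp h'.mapsTo_inv
  leftInvOn x hx := by
    simp only [Function.comp_apply]
    rw [h'.leftInvOn (h.mapsTo hx), h.leftInvOn hx]
  rightInvOn x hx := by
    simp only [Function.comp_apply]
    rw [h.rightInvOn (h'.mapsTo_inv hx), h'.rightInvOn hx]

theorem image_eq (h : HolomorphicEquivOn f g D D') : f '' D = D' :=
  Subset.antisymm h.mapsTo.image_subset
    fun y hy => ⟨g y, h.mapsTo_inv hy, h.rightInvOn hy⟩

/-- The image of an open set is its preimage under `g`, so continuity of the inverse suffices. -/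
theorem isOpenHolomorphicEmbedding (h : HolomorphicEquivOn f g D D') (hD' : IsOpen D') :
    IsOpenHolomorphicEmbedding D f := by
  refine ⟨h.differentiableOn, .of_continuous_injective_isOpenMap
    h.differentiableOn.continuousOn.domRestrict ?_ ?_⟩
  · intro x y hxy
    exact Subtype.ext (h.leftInvOn.injOn x.2 y.2 hxy)
  · intro U hU
    obtain ⟨V, hV, rfl⟩ := isOpen_induced_iff.mp hU
    have : D.domRestrict f '' (Subtype.val ⁻¹' V) = D' ∩ g ⁻¹' V := by
      ext y
      constructor
      · rintro ⟨x, hx, rfl⟩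
        refine ⟨h.mapsTo x.2, ?_⟩
        change g (f x) ∈ V
        rw [h.leftInvOn x.2]
        exact hx
      · rintro ⟨hy, hyV⟩
        exact ⟨⟨g y, h.mapsTo_inv hy⟩, hyV, h.rightInvOn hy⟩
    rw [this]
    exact h.continuousOn.isOpen_inter_preimage hD' hV

/-- A continuous linear equivalence, restricted to a set. -/
theorem of_continuousLinearEquiv (e : E ≃L[ℂ] F) (D : Set E) :
    HolomorphicEquivOn e e.symm D (e.symm ⁻¹' D) where
  differentiableOn := e.differentiable.differentiableOn
  continuousOn := e.symm.continuous.continuousOn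
  mapsTo x hx := by simpa using hx
  mapsTo_inv x hx := hx
  leftInvOn x _ := e.symm_apply_apply x
  rightInvOn x _ := e.apply_symm_apply x

/-- The affine map `x ↦ c (x - a)`, restricted to a set. -/
theorem of_affine {c : ℂ} (hc : c ≠ 0) (a : E) (D : Set E) :
    HolomorphicEquivOn (fun x => c • (x - a)) (fun y => c⁻¹ • y + a) D
      ((fun y => c⁻¹ • y + a) ⁻¹' D) where
  differentiableOn := by fun_prop
  continuousOn := by fun_prop
  mapsTo x hx := by simpa [smul_smul, hc] using hx
  mapsTo_inv x hx := hx
  leftInvOn x _ := by simp [smul_smul, hc]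
  rightInvOn x _ := by simp [smul_smul, hc]

end HolomorphicEquivOn

/-! ### Elementary bounds for the squeezing function -/

section SqueezingBounds

variable {E : Type*} [NormedAddCommGroup E] [NormedSpace ℂ E]

theorem le_one_of_ball_subset_ball {G : Type*} [NormedAddCommGroup G] [NormedSpace ℂ G]
    [Nontrivial G] {r : ℝ} (h : Metric.ball (0 : G) r ⊆ Metric.ball 0 1) : r ≤ 1 := by
  by_contra! hr
  obtain ⟨v, hv⟩ := NormedSpace.exists_lt_norm ℂ G 0
  have hw : ‖((‖v‖⁻¹ : ℝ) : ℂ) • v‖ = 1 := by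
    rw [norm_smul, Complex.norm_real, norm_inv, norm_norm, inv_mul_cancel₀ hv.ne']
  have := h (mem_ball_zero_iff.2 (hw.trans_lt hr))
  rw [mem_ball_zero_iff, hw] at this
  exact lt_irrefl _ this

/-- Boundedness is essential for `le_csSup`: the real `sSup` of an unbounded set is `0`. In
dimension zero every ball is the whole space, hence `Nontrivial`. -/
theorem squeezingAlong_bddAbove [FiniteDimensional ℂ E] [Nontrivial E] {D : Set E}
    {f : E → EuclideanSpace ℂ (Fin (Module.finrank ℂ E))} (hf : MapsTo f D (Metric.ball 0 1)) :
    1 ∈ upperBounds {r : ℝ | Metric.ball 0 r ⊆ f '' D} := by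
  have : Nonempty (Fin (Module.finrank ℂ E)) := Fin.pos_iff_nonempty.1 Module.finrank_pos
  exact fun r hr => le_one_of_ball_subset_ball (hr.trans hf.image_subset)

theorem squeezingAlong_le_one [FiniteDimensional ℂ E] [Nontrivial E] {D : Set E}
    {f : E → EuclideanSpace ℂ (Fin (Module.finrank ℂ E))} (hf : MapsTo f D (Metric.ball 0 1)) :
    squeezingAlong D f ≤ 1 :=
  Real.sSup_le (squeezingAlong_bddAbove hf) zero_le_one

theorem squeezingFunction_le_one [FiniteDimensional ℂ E] [Nontrivial E] (D : Set E) (z : E) :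
    squeezingFunction D z ≤ 1 := by
  refine Real.sSup_le ?_ zero_le_one
  rintro x ⟨f, -, hf, -, rfl⟩
  exact squeezingAlong_le_one hf

/-- A holomorphic embedding of `D` into a ball of radius `R`, whose image contains a concentric ball
of radius `r`, bounds the squeezing function from below by `r / R`. -/
theorem div_le_squeezingFunction [FiniteDimensional ℂ E] [Nontrivial E]
    {G : Type*} [NormedAddCommGroup G] [InnerProductSpace ℂ G] [FiniteDimensional ℂ G]
    (hG : Module.finrank ℂ G = Module.finrank ℂ E) {D : Set E} {D' : Set G} {f : E → G} {g : G → E}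
    (h : HolomorphicEquivOn f g D D') (hD' : IsOpen D') {z : E} (hz : f z = 0) {r R : ℝ}
    (hR : 0 < R) (hDR : D' ⊆ Metric.ball 0 R) (hr : Metric.ball 0 r ⊆ D') :
    r / R ≤ squeezingFunction D z := by
  -- An orthonormal basis identifies `G` with the standard space without changing balls; dividing by
  -- `R` then normalizes the outer ball.
  let i : G ≃ₗᵢ[ℂ] EuclideanSpace ℂ (Fin (Module.finrank ℂ E)) :=
    ((stdOrthonormalBasis ℂ G).reindex (finCongr hG)).repr
  have hRc : ((R : ℂ)⁻¹) ≠ 0 := by simpa using hR.ne'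
  have h1 := (h.trans (.of_continuousLinearEquiv i.toContinuousLinearEquiv D')).trans
    (.of_affine hRc 0 _)
  set F := (fun x : EuclideanSpace ℂ (Fin (Module.finrank ℂ E)) => (R : ℂ)⁻¹ • (x - 0)) ∘
    i.toContinuousLinearEquiv ∘ f with hF
  have hopen : IsOpen ((fun y : EuclideanSpace ℂ (Fin (Module.finrank ℂ E)) =>
      (R : ℂ)⁻¹⁻¹ • y + 0) ⁻¹' (i.toContinuousLinearEquiv.symm ⁻¹' D')) :=
    (hD'.preimage i.toContinuousLinearEquiv.symm.continuous).preimage (by fun_prop)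
  have hmem : MapsTo F D (Metric.ball 0 1) := by
    intro x hx
    have h2 := mem_ball_zero_iff.1 (hDR (h.mapsTo hx))
    rw [mem_ball_zero_iff]
    change ‖(R : ℂ)⁻¹ • (i (f x) - 0)‖ < 1
    rw [sub_zero, norm_smul, i.norm_map, norm_inv, Complex.norm_real, Real.norm_of_nonneg hR.le,
      inv_mul_lt_iff₀ hR]
    simpa using h2
  have h3 : r / R ≤ squeezingAlong D F := by
    refine le_csSup ⟨1, squeezingAlong_bddAbove hmem⟩ ?_
    intro y hy
    rw [h1.image_eq]
    refine hr ?_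
    rw [mem_ball_zero_iff] at hy ⊢
    change ‖i.symm ((R : ℂ)⁻¹⁻¹ • y + 0)‖ < r
    rw [i.symm.norm_map, add_zero, inv_inv, norm_smul, Complex.norm_real,
      Real.norm_of_nonneg hR.le, mul_comm]
    exact (lt_div_iff₀ hR).1 hy
  refine h3.trans (le_csSup ⟨1, ?_⟩ ⟨F, h1.isOpenHolomorphicEmbedding hopen, hmem, ?_, rfl⟩)
  · rintro x ⟨f, -, hf, -, rfl⟩
    exact squeezingAlong_le_one hf
  · change (R : ℂ)⁻¹ • (i (f z) - 0) = 0
    rw [hz]; simp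

end SqueezingBounds

/-! ### Automorphisms of the unit ball and almost spherical domains -/

section BallMap

variable {G : Type*} [NormedAddCommGroup G] [InnerProductSpace ℂ G]

/-- The automorphism of the unit ball that moves `w e` to the origin, for a unit vector `e`. -/
noncomputable def ballMap (e : G) (w : ℝ) (v : G) : G :=
  (1 - w * inner ℂ e v)⁻¹ • ((inner ℂ e v - w) • e +
    (√(1 - w ^ 2) : ℂ) • (v - inner ℂ e v • e))

variable {e : G} {w : ℝ} {v : G}

theorem inner_self_of_norm_one (he : ‖e‖ = 1) : inner ℂ e e = (1 : ℂ) := by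
  rw [inner_self_eq_norm_sq_to_K, he]; simp

theorem inner_sub_inner_smul (he : ‖e‖ = 1) (v : G) :
    inner ℂ e (v - inner ℂ e v • e) = (0 : ℂ) := by
  rw [inner_sub_right, inner_smul_right, inner_self_of_norm_one he, mul_one, sub_self]

/-- The component along `e` undergoes the disc automorphism, which reduces the later identities to
one complex variable. -/
theorem inner_ballMap (he : ‖e‖ = 1) :
    inner ℂ e (ballMap e w v) = (inner ℂ e v - w) / (1 - w * inner ℂ e v) := by
  rw [ballMap, inner_smul_right, inner_add_right, inner_smul_right, inner_smul_right,
    inner_sub_inner_smul he, inner_self_of_norm_one he]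
  ring

theorem norm_smul_add_sq (he : ‖e‖ = 1) (a b : ℂ) {p : G} (hp : inner ℂ e p = (0 : ℂ)) :
    ‖a • e + b • p‖ ^ 2 = ‖a‖ ^ 2 + ‖b‖ ^ 2 * ‖p‖ ^ 2 := by
  have := norm_add_sq_eq_norm_sq_add_norm_sq_of_inner_eq_zero (𝕜 := ℂ) (a • e) (b • p)
    (by rw [inner_smul_left, inner_smul_right, hp]; simp)
  rw [sq, this, norm_smul, norm_smul, he]
  ring

theorem norm_sq_eq_inner_add (he : ‖e‖ = 1) (v : G) :
    ‖v‖ ^ 2 = ‖(inner ℂ e v : ℂ)‖ ^ 2 + ‖v - (inner ℂ e v : ℂ) • e‖ ^ 2 := by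
  have := norm_smul_add_sq he (inner ℂ e v) 1 (inner_sub_inner_smul he v)
  simpa using this

theorem ballMap_neg_ballMap (he : ‖e‖ = 1) (hw : w ^ 2 < 1) (hv : 1 - w * inner ℂ e v ≠ (0 : ℂ)) :
    ballMap e (-w) (ballMap e w v) = v := by
  have hw' : (1 - w ^ 2 : ℂ) ≠ 0 := by
    have : ((1 - w ^ 2 : ℝ) : ℂ) ≠ 0 := Complex.ofReal_ne_zero.2 (by linarith)
    simpa using this
  have hc : (√(1 - w ^ 2) : ℂ) * (√(1 - w ^ 2) : ℂ) = 1 - w ^ 2 := by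
    rw [← Complex.ofReal_mul, Real.mul_self_sqrt (by linarith)]; simp
  have hi := inner_ballMap (w := w) (v := v) he
  rw [ballMap, hi]
  generalize hcc : (√(1 - w ^ 2) : ℂ) = c at hc
  have hp : ballMap e w v - ((inner ℂ e v - w) / (1 - w * inner ℂ e v) : ℂ) • e =
      ((1 - w * inner ℂ e v)⁻¹ * c : ℂ) • (v - (inner ℂ e v : ℂ) • e) := by
    rw [ballMap, hcc, smul_add, smul_smul, smul_smul, div_eq_inv_mul]
    abel
  rw [hp, neg_sq, hcc]
  generalize (inner ℂ e v : ℂ) = a at hv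
  have h1 : (1 - ((-w : ℝ) : ℂ) * ((a - w) / (1 - w * a))) = (1 - w ^ 2) / (1 - w * a) := by
    rw [Complex.ofReal_neg]; field_simp; ring
  have h2 : ((a - w) / (1 - w * a) - ((-w : ℝ) : ℂ)) = a * (1 - w ^ 2) / (1 - w * a) := by
    rw [Complex.ofReal_neg, sub_neg_eq_add, div_add' _ _ _ hv]; congr 1; ring
  rw [h1, h2, smul_add, smul_smul, smul_smul, smul_smul]
  have h3 : ((1 - w ^ 2) / (1 - w * a) : ℂ)⁻¹ * (a * (1 - w ^ 2) / (1 - w * a)) = a := by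
    field_simp
  have h4 : ((1 - w ^ 2) / (1 - w * a) : ℂ)⁻¹ * c * ((1 - w * a)⁻¹ * c) = 1 := by
    rw [show ∀ x y : ℂ, x * c * (y * c) = x * y * (c * c) by intros; ring, hc]
    field_simp
  rw [h3, h4]
  simp

/-- Splitting off the component along `e` leaves the disc identity `|1 - wa|² - |a - w|² = (1 -
w²)(1 - |a|²)`. No bound on `‖v‖` is assumed, so the formula also covers points outside the ball. -/
theorem one_sub_norm_ballMap_sq (he : ‖e‖ = 1) (hw : w ^ 2 < 1)
    (hv : 1 - w * inner ℂ e v ≠ (0 : ℂ)) :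
    (1 - ‖ballMap e w v‖ ^ 2) * ‖(1 - w * inner ℂ e v : ℂ)‖ ^ 2 =
      (1 - w ^ 2) * (1 - ‖v‖ ^ 2) := by
  have h0 : ‖(1 - w * inner ℂ e v : ℂ)‖ ≠ 0 := norm_ne_zero_iff.2 hv
  rw [ballMap, norm_smul, mul_pow, norm_smul_add_sq he _ _ (inner_sub_inner_smul he v),
    norm_sq_eq_inner_add he v, norm_inv, Complex.norm_real, Real.norm_eq_abs, sq_abs,
    Real.sq_sqrt (by linarith)]
  generalize ‖v - (inner ℂ e v : ℂ) • e‖ ^ 2 = q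
  generalize (inner ℂ e v : ℂ) = a at h0
  have h1 : ‖1 - w * a‖ ^ 2 - ‖a - w‖ ^ 2 = (1 - w ^ 2) * (1 - ‖a‖ ^ 2) := by
    simp only [← Complex.normSq_eq_norm_sq, Complex.normSq_apply]
    simp
    ring
  field_simp
  linarith

theorem norm_one_sub_le (hw : 0 ≤ w) (hw1 : w < 1) (a : ℂ) : 1 - ‖a‖ ≤ ‖1 - w * a‖ := by
  have h1 := norm_sub_norm_le (1 : ℂ) (w * a)
  rw [norm_one, norm_mul, Complex.norm_real, Real.norm_of_nonneg hw] at h1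
  nlinarith [norm_nonneg a]

/-- Writing the image as a preimage under the inverse map makes its openness immediate in
`isOpen_ballMap_image`. -/
theorem holomorphicEquivOn_ballMap (he : ‖e‖ = 1) (hw : w ^ 2 < 1) {D : Set G}
    (hD : ∀ v ∈ D, 1 - w * inner ℂ e v ≠ (0 : ℂ)) :
    HolomorphicEquivOn (ballMap e w) (ballMap e (-w)) D
      ({u | 1 - ((-w : ℝ) : ℂ) * inner ℂ e u ≠ (0 : ℂ)} ∩ ballMap e (-w) ⁻¹' D) where
  differentiableOn := by
    have hi : Differentiable ℂ fun v : G => (inner ℂ e v : ℂ) := (innerSL ℂ e).differentiable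
    unfold ballMap
    exact ((hi.const_mul _).const_sub _).differentiableOn.inv hD |>.smul
      (((hi.sub_const _).smul_const _).add
        ((differentiable_id.sub (hi.smul_const _)).const_smul _)).differentiableOn
  continuousOn := by
    have hi : Continuous fun v : G => (inner ℂ e v : ℂ) := (innerSL ℂ e).continuous
    unfold ballMap
    refine ContinuousOn.smul (ContinuousOn.inv₀ (by fun_prop) fun u hu => hu.1) ?_
    fun_prop
  mapsTo v hv := by
    have hw' : (1 - w ^ 2 : ℂ) ≠ 0 := by
      have : ((1 - w ^ 2 : ℝ) : ℂ) ≠ 0 := Complex.ofReal_ne_zero.2 (by linarith)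
      simpa using this
    refine ⟨?_, ?_⟩
    · rw [mem_ofPred_eq, inner_ballMap he]
      have h0 := hD v hv
      have h1 : 1 - ((-w : ℝ) : ℂ) * ((inner ℂ e v - w) / (1 - w * inner ℂ e v)) =
          (1 - w ^ 2) / (1 - w * inner ℂ e v) := by
        rw [Complex.ofReal_neg]; field_simp; ring
      rw [h1]
      exact div_ne_zero hw' h0
    · rw [mem_preimage, ballMap_neg_ballMap he hw (hD v hv)]
      exact hv
  mapsTo_inv u hu := hu.2
  leftInvOn v hv := ballMap_neg_ballMap he hw (hD v hv)
  rightInvOn u hu := by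
    have := ballMap_neg_ballMap (w := -w) he (by simpa using hw) hu.1
    rwa [neg_neg] at this

theorem isOpen_ballMap_image {D : Set G} (hD : IsOpen D) :
    IsOpen ({u | 1 - w * inner ℂ e u ≠ (0 : ℂ)} ∩ ballMap e w ⁻¹' D) := by
  have hi : Continuous fun v : G => (inner ℂ e v : ℂ) := (innerSL ℂ e).continuous
  refine ContinuousOn.isOpen_inter_preimage ?_ ?_ hD
  · unfold ballMap
    refine ContinuousOn.smul (ContinuousOn.inv₀ (by fun_prop) fun u hu => hu) ?_
    fun_prop
  · exact isOpen_ne_fun (by fun_prop) continuous_const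

theorem ballMap_apply_center (he : ‖e‖ = 1) : ballMap e w ((w : ℂ) • e) = 0 := by
  rw [ballMap, inner_smul_right, inner_self_of_norm_one he]
  simp

/-- If a domain agrees with the unit ball up to an error of order `(1 - |⟨e, v⟩|)²` near a boundary
point `e` at which the hyperplane `⟨e, v⟩ = 1` supports it, then the ball automorphism moving `w e`
to the origin maps it onto a domain between two balls with radii close to one. -/
theorem ballMap_image_between (he : ‖e‖ = 1) {D : Set G} {C δ ε : ℝ} (hδ : 0 < δ)
    (hε : 0 < ε) (hC : 0 ≤ C)
    (h₁ : ∀ v ∈ D, ‖(inner ℂ e v : ℂ)‖ < 1 ∧ ‖v‖ ^ 2 - 1 ≤ C * (1 - ‖(inner ℂ e v : ℂ)‖) ^ 2)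
    (h₂ : ∀ v, ‖v‖ < 1 → 1 - ‖(inner ℂ e v : ℂ)‖ < δ →
      C * (1 - ‖(inner ℂ e v : ℂ)‖) ^ 2 < 1 - ‖v‖ ^ 2 → v ∈ D)
    (hw : 0 ≤ w) (hw1 : w < 1) (hwC : (1 - w ^ 2) * C < ε) (hwδ : 1 - w ^ 2 < ε * δ ^ 2) :
    HolomorphicEquivOn (ballMap e w) (ballMap e (-w)) D
      ({u | 1 - ((-w : ℝ) : ℂ) * inner ℂ e u ≠ (0 : ℂ)} ∩ ballMap e (-w) ⁻¹' D) ∧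
    ({u | 1 - ((-w : ℝ) : ℂ) * inner ℂ e u ≠ (0 : ℂ)} ∩ ballMap e (-w) ⁻¹' D) ⊆
      Metric.ball 0 (1 + ε) ∧
    Metric.ball 0 (1 - ε) ⊆
      ({u | 1 - ((-w : ℝ) : ℂ) * inner ℂ e u ≠ (0 : ℂ)} ∩ ballMap e (-w) ⁻¹' D) := by
  have hw2 : w ^ 2 < 1 := by nlinarith
  have hpos : ∀ v : G, ‖(inner ℂ e v : ℂ)‖ < 1 → 0 < ‖(1 - w * inner ℂ e v : ℂ)‖ := fun v hv =>
    (sub_pos.2 hv).trans_le (norm_one_sub_le hw hw1 _)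
  have hne : ∀ v : G, ‖(inner ℂ e v : ℂ)‖ < 1 → 1 - w * inner ℂ e v ≠ (0 : ℂ) :=
    fun v hv => norm_pos_iff.1 (hpos v hv)
  have hequiv := holomorphicEquivOn_ballMap he hw2 fun v hv => hne v (h₁ v hv).1
  refine ⟨hequiv, ?_, ?_⟩
  · rw [← hequiv.image_eq]
    rintro _ ⟨v, hv, rfl⟩
    rw [mem_ball_zero_iff]
    obtain ⟨ha, hvC⟩ := h₁ v hv
    have h3 := one_sub_norm_ballMap_sq he hw2 (hne v ha)
    have h4 := norm_one_sub_le hw hw1 (inner ℂ e v)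
    have h5 := hpos v ha
    generalize ‖(1 - w * inner ℂ e v : ℂ)‖ = t at h3 h4 h5
    -- The factor `t²` from the transformation law absorbs `(1 - |⟨e, v⟩|)²`, leaving the small
    -- constant `(1 - w²) C`.
    have h6 : (‖ballMap e w v‖ ^ 2 - 1) * t ^ 2 ≤ ((1 - w ^ 2) * C) * t ^ 2 := by
      have : (1 - ‖(inner ℂ e v : ℂ)‖) ^ 2 ≤ t ^ 2 := pow_le_pow_left₀ (by linarith) h4 2
      have h7 : ‖v‖ ^ 2 - 1 ≤ C * t ^ 2 := hvC.trans (by gcongr)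
      nlinarith
    have h7 := le_of_mul_le_mul_right h6 (by positivity)
    have h8 : ‖ballMap e w v‖ ^ 2 < (1 + ε) ^ 2 := by nlinarith
    exact lt_of_pow_lt_pow_left₀ 2 (by linarith) h8
  · intro u hu
    rw [mem_ball_zero_iff] at hu
    have hu1 : ‖(inner ℂ e u : ℂ)‖ < 1 := by
      have := norm_inner_le_norm (𝕜 := ℂ) e u
      rw [he, one_mul] at this
      linarith
    have hu2 : 1 - ((-w : ℝ) : ℂ) * inner ℂ e u ≠ (0 : ℂ) := by
      intro h
      have h3 : ((-w : ℝ) : ℂ) * inner ℂ e u = 1 := (sub_eq_zero.1 h).symm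
      have h4 := congrArg norm h3
      rw [norm_mul, Complex.norm_real, norm_neg, Real.norm_of_nonneg hw, norm_one] at h4
      nlinarith [norm_nonneg (inner ℂ e u : ℂ)]
    refine ⟨hu2, ?_⟩
    have h3 := one_sub_norm_ballMap_sq (w := -w) he (by simpa using hw2) hu2
    rw [mem_preimage]
    have hback := ballMap_neg_ballMap (w := -w) he (by simpa using hw2) hu2
    rw [neg_neg] at hback
    have huε : ε ≤ 1 - ‖u‖ ^ 2 := by nlinarith [norm_nonneg u]
    set v := ballMap e (-w) u with hv
    have hv1 : ‖v‖ < 1 := by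
      have h4 : 0 < (1 - (-w) ^ 2) * (1 - ‖u‖ ^ 2) := mul_pos (by nlinarith) (by linarith)
      rw [← h3] at h4
      have h5 := pos_of_mul_pos_left h4 (by positivity)
      nlinarith [norm_nonneg v]
    have ha : ‖(inner ℂ e v : ℂ)‖ < 1 := by
      have := norm_inner_le_norm (𝕜 := ℂ) e v
      rw [he, one_mul] at this
      linarith
    have h4 := one_sub_norm_ballMap_sq he hw2 (hne v ha)
    rw [hback] at h4
    have h5 := norm_one_sub_le hw hw1 (inner ℂ e v)
    have h6 := hpos v ha
    generalize ‖(1 - w * inner ℂ e v : ℂ)‖ = t at h4 h5 h6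
    -- The transformation law for the inverse map: a point `u` at depth at least `ε` comes from a
    -- `v` whose depth dominates `t²`, hence the error allowed in `h₂`.
    have h7 : ε * t ^ 2 ≤ (1 - w ^ 2) * (1 - ‖v‖ ^ 2) := by
      rw [← h4]; gcongr
    generalize hη : 1 - w ^ 2 = η at *
    have hη0 : 0 < η := by linarith
    have ha' : 0 < 1 - ‖(inner ℂ e v : ℂ)‖ := by linarith
    have h9 : (1 - ‖(inner ℂ e v : ℂ)‖) ^ 2 ≤ t ^ 2 := pow_le_pow_left₀ ha'.le h5 2
    refine h₂ v hv1 ?_ ?_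
    · have h8 : ε * t ^ 2 < ε * δ ^ 2 := by nlinarith [norm_nonneg v]
      have h10 := lt_of_mul_lt_mul_left h8 hε.le
      exact lt_of_pow_lt_pow_left₀ 2 hδ.le (h9.trans_lt h10)
    · have h8 : η * C * (1 - ‖(inner ℂ e v : ℂ)‖) ^ 2 < ε * (1 - ‖(inner ℂ e v : ℂ)‖) ^ 2 := by
        gcongr
      have h10 : ε * (1 - ‖(inner ℂ e v : ℂ)‖) ^ 2 ≤ ε * t ^ 2 := by gcongr
      have h11 : η * (C * (1 - ‖(inner ℂ e v : ℂ)‖) ^ 2) < η * (1 - ‖v‖ ^ 2) := by linarith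
      exact lt_of_mul_lt_mul_left h11 hη0.le

end BallMap

/-! ### Hartogs domains over a homogeneous base -/

section Hartogs

variable {V X Y : Type*} [NormedAddCommGroup V] [NormedSpace ℂ V]
  [NormedAddCommGroup X] [InnerProductSpace ℂ X] [NormedAddCommGroup Y] [InnerProductSpace ℂ Y]

/-- A bounded homogeneous domain `Ω`, star-shaped about the origin, with a positive function `N` on
it that is multiplied by the modulus of a holomorphic function under transitively acting
automorphisms, and that lies between `1 - ‖ℓ Z‖²` and `exp (-‖ℓ Z‖²)` for a Euclidean norm. -/
structure HomogeneousBase (Ω : Set V) (N : V → ℝ) (ℓ : V ≃L[ℂ] X) : Prop where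
  isOpen : IsOpen Ω
  isBounded : Bornology.IsBounded Ω
  zero_mem : 0 ∈ Ω
  smul_mem : ∀ Z ∈ Ω, ∀ t : ℝ, 0 ≤ t → t ≤ 1 → (t : ℂ) • Z ∈ Ω
  continuous : Continuous N
  pos : ∀ Z ∈ Ω, 0 < N Z
  mem_of_closure : ∀ Z ∈ closure Ω, 0 < N Z → Z ∈ Ω
  lower : ∀ Z ∈ Ω, 1 - ‖ℓ Z‖ ^ 2 ≤ N Z
  upper : ∀ Z ∈ Ω, N Z ≤ Real.exp (-‖ℓ Z‖ ^ 2)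
  transitive : ∀ A ∈ Ω, ∃ (φ ψ : V → V) (h : V → ℂ), HolomorphicEquivOn φ ψ Ω Ω ∧ φ A = 0 ∧
    DifferentiableOn ℂ h Ω ∧ ∀ Z ∈ Ω, N (φ Z) = N Z * Real.exp (h Z).re

/-- The Hartogs domain `‖W‖² < N(Z)ᵏ` over `Ω`. -/
def hartogs (Y : Type*) [NormedAddCommGroup Y] (Ω : Set V) (N : V → ℝ) (k : ℝ) : Set (V × Y) :=
  {P | P.1 ∈ Ω ∧ ‖P.2‖ ^ 2 < N P.1 ^ k}

/-- With `y = q / k ≤ 1/2`, one has `log (1 - y) ≥ 1 - (1 - y)⁻¹ ≥ -y - 2y²`; then `exp x ≥ 1 + x`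
gives the bound, whatever the size of `k`. -/
theorem one_sub_le_rpow {k q x : ℝ} (hk : 0 < k) (hq : q ≤ k / 2) (h : 1 - q / k ≤ x) :
    1 - q - 2 / k * q ^ 2 ≤ x ^ k := by
  have hy : q / k ≤ 1 / 2 := by rw [div_le_iff₀ hk]; linarith
  set y := q / k with hyd
  have hq' : q = k * y := by rw [hyd]; field_simp
  have h0 : 0 < 1 - y := by linarith
  have h1 : -y - 2 * y ^ 2 ≤ Real.log (1 - y) := by
    have h2 := Real.one_sub_inv_le_log_of_pos h0
    have h3 : (1 - y)⁻¹ ≤ 1 + y + 2 * y ^ 2 := by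
      rw [inv_le_iff_one_le_mul₀ h0]
      nlinarith [mul_nonneg (sq_nonneg y) (by linarith : (0 : ℝ) ≤ 1 - 2 * y)]
    linarith
  calc 1 - q - 2 / k * q ^ 2 = (-y - 2 * y ^ 2) * k + 1 := by rw [hq']; field_simp; ring
    _ ≤ Real.exp ((-y - 2 * y ^ 2) * k) := Real.add_one_le_exp _
    _ ≤ Real.exp (Real.log (1 - y) * k) := by gcongr
    _ = (1 - y) ^ k := by rw [Real.rpow_def_of_pos h0]
    _ ≤ x ^ k := Real.rpow_le_rpow h0.le h hk.le

theorem exp_neg_le_inv {q : ℝ} (hq : 0 ≤ q) : Real.exp (-q) ≤ (1 + q)⁻¹ := by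
  rw [Real.exp_neg]
  have := Real.add_one_le_exp q
  gcongr
  linarith

namespace HomogeneousBase

variable {Ω : Set V} {N : V → ℝ} {ℓ : V ≃L[ℂ] X} {k : ℝ}

theorem map_zero (h : HomogeneousBase Ω N ℓ) : N 0 = 1 := by
  have h1 := h.lower 0 h.zero_mem
  have h2 := h.upper 0 h.zero_mem
  simp only [_root_.map_zero, norm_zero, ne_eq, OfNat.ofNat_ne_zero, not_false_eq_true, zero_pow,
    sub_zero, neg_zero, Real.exp_zero] at h1 h2
  exact le_antisymm h2 h1

theorem rpow_le (h : HomogeneousBase Ω N ℓ) (hk : 0 < k) {Z : V} (hZ : Z ∈ Ω) :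
    N Z ^ k ≤ Real.exp (-(k * ‖ℓ Z‖ ^ 2)) := by
  refine (Real.rpow_le_rpow (h.pos Z hZ).le (h.upper Z hZ) hk.le).trans_eq ?_
  rw [← Real.exp_mul]
  congr 1; ring

theorem continuous_rpow {Y : Type*} [NormedAddCommGroup Y] (h : HomogeneousBase Ω N ℓ) (hk : 0 < k) :
    Continuous fun P : V × Y => N P.1 ^ k :=
  (h.continuous.comp continuous_fst).rpow_const fun _ => .inr hk.le

theorem isOpen_hartogs {Y : Type*} [NormedAddCommGroup Y] (h : HomogeneousBase Ω N ℓ) (hk : 0 < k) : IsOpen (hartogs Y Ω N k) :=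
  (h.isOpen.preimage continuous_fst).inter
    (isOpen_lt (by fun_prop) (h.continuous_rpow hk))

theorem norm_snd_lt_one {Y : Type*} [NormedAddCommGroup Y] (h : HomogeneousBase Ω N ℓ) (hk : 0 < k) {P : V × Y}
    (hP : P ∈ hartogs Y Ω N k) : ‖P.2‖ < 1 := by
  have h1 : Real.exp (-(k * ‖ℓ P.1‖ ^ 2)) ≤ 1 := Real.exp_le_one_iff.2 (by simp; positivity)
  have h2 := (hP.2.trans_le (h.rpow_le hk hP.1)).trans_le h1
  exact (sq_lt_one_iff₀ (norm_nonneg _)).1 h2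

theorem isBounded_hartogs {Y : Type*} [NormedAddCommGroup Y] (h : HomogeneousBase Ω N ℓ) (hk : 0 < k) :
    Bornology.IsBounded (hartogs Y Ω N k) := by
  refine (h.isBounded.prod (Metric.isBounded_ball (x := (0 : Y)) (r := 1))).subset ?_
  intro P hP
  exact ⟨hP.1, mem_ball_zero_iff.2 (h.norm_snd_lt_one hk hP)⟩

theorem isConnected_hartogs (h : HomogeneousBase Ω N ℓ) : IsConnected (hartogs Y Ω N k) := by
  have hN := fun Z hZ => Real.rpow_pos_of_pos (h.pos Z hZ) k
  have h0 : ((0 : V), (0 : Y)) ∈ hartogs Y Ω N k :=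
    ⟨h.zero_mem, by simpa using hN 0 h.zero_mem⟩
  refine IsPathConnected.isConnected ⟨(0, 0), h0, fun {P} hP => ?_⟩
  -- Shrink `W` to `0` in its fibre, then move the base point radially to the origin.
  refine (JoinedIn.trans (y := (P.1, (0 : Y))) ?_ ?_).symm
  · refine JoinedIn.ofLine (f := fun t : ℝ => (P.1, ((1 - t : ℝ) : ℂ) • P.2))
      (by fun_prop) (by simp) (by simp) ?_
    rintro _ ⟨t, ⟨ht0, ht1⟩, rfl⟩
    refine ⟨hP.1, lt_of_le_of_lt ?_ hP.2⟩
    rw [norm_smul, Complex.norm_real, Real.norm_of_nonneg (by linarith)]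
    gcongr
    exact mul_le_of_le_one_left (norm_nonneg _) (by linarith)
  · refine JoinedIn.ofLine (f := fun t : ℝ => (((1 - t : ℝ) : ℂ) • P.1, (0 : Y)))
      (by fun_prop) (by simp) (by simp) ?_
    rintro _ ⟨t, ⟨ht0, ht1⟩, rfl⟩
    have hZ := h.smul_mem P.1 hP.1 (1 - t) (by linarith) (by linarith)
    exact ⟨hZ, by simpa using hN _ hZ⟩

/-- Every point of the Hartogs domain is moved by an automorphism into the fibre over the origin. -/
theorem exists_equiv_hartogs (h : HomogeneousBase Ω N ℓ) {P : V × Y}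
    (hP : P ∈ hartogs Y Ω N k) :
    ∃ (f g : V × Y → V × Y) (W : Y),
      HolomorphicEquivOn f g (hartogs Y Ω N k) (hartogs Y Ω N k) ∧ f P = (0, W) ∧
        ‖W‖ ^ 2 = ‖P.2‖ ^ 2 / N P.1 ^ k := by
  obtain ⟨φ, ψ, j, hφ, hA, hj, hN⟩ := h.transitive P.1 hP.1
  have hnorm : ∀ (c : ℂ) (W : Y), ‖Complex.exp (k / 2 * c) • W‖ ^ 2 =
      Real.exp c.re ^ k * ‖W‖ ^ 2 := by
    intro c W
    rw [norm_smul, mul_pow, Complex.norm_exp, ← Real.exp_mul, sq (Real.exp _), ← Real.exp_add]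
    congr 2
    simp
    ring
  have hNk : ∀ Z ∈ Ω, N (φ Z) ^ k = Real.exp (j Z).re ^ k * N Z ^ k := by
    intro Z hZ
    rw [hN Z hZ, Real.mul_rpow (h.pos Z hZ).le (Real.exp_pos _).le, mul_comm]
  have hpos : ∀ x : ℝ, 0 < Real.exp x ^ k := fun x => Real.rpow_pos_of_pos (Real.exp_pos x) k
  have hfst : MapsTo Prod.fst (hartogs Y Ω N k) Ω := fun Q hQ => hQ.1
  have hinv : ∀ (c : ℂ) (W : Y), Complex.exp (-(k / 2 * c)) • Complex.exp (k / 2 * c) • W = W := by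
    intro c W
    rw [smul_smul, ← Complex.exp_add, neg_add_cancel, Complex.exp_zero, one_smul]
  have hinv' : ∀ (c : ℂ) (W : Y), Complex.exp (k / 2 * c) • Complex.exp (-(k / 2 * c)) • W = W := by
    intro c W
    rw [smul_smul, ← Complex.exp_add, add_neg_cancel, Complex.exp_zero, one_smul]
  -- The fibre factor has `|exp (k j / 2)|² = exp(Re j)ᵏ`, which is exactly the factor by which `Nᵏ`
  -- changes. A logarithm `j` of the automorphy factor makes this holomorphic for every real `k`.
  refine ⟨fun Q => (φ Q.1, Complex.exp (k / 2 * j Q.1) • Q.2),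
    fun Q => (ψ Q.1, Complex.exp (-(k / 2 * j (ψ Q.1))) • Q.2), _, ⟨?_, ?_, ?_, ?_, ?_, ?_⟩,
    Prod.ext hA rfl, ?_⟩
  · refine (hφ.differentiableOn.comp differentiableOn_fst hfst).prodMk (.smul ?_ differentiableOn_snd)
    exact ((hj.comp differentiableOn_fst hfst).const_mul _).cexp
  · refine (hφ.continuousOn.comp continuousOn_fst hfst).prodMk (.smul ?_ continuousOn_snd)
    refine Complex.continuous_exp.comp_continuousOn (ContinuousOn.neg (continuousOn_const.mul ?_))
    exact hj.continuousOn.comp (hφ.continuousOn.comp continuousOn_fst hfst)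
      fun Q hQ => hφ.mapsTo_inv hQ.1
  · intro Q hQ
    refine ⟨hφ.mapsTo hQ.1, ?_⟩
    simp only [hnorm, hNk _ hQ.1]
    exact mul_lt_mul_of_pos_left hQ.2 (hpos _)
  · intro Q hQ
    have hZ := hφ.mapsTo_inv hQ.1
    refine ⟨hZ, ?_⟩
    have h1 := hnorm (j (ψ Q.1)) (Complex.exp (-(k / 2 * j (ψ Q.1))) • Q.2)
    rw [hinv'] at h1
    have h2 := hNk _ hZ
    rw [hφ.rightInvOn hQ.1] at h2
    have h3 := hQ.2
    rw [h1, h2] at h3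
    exact lt_of_mul_lt_mul_left h3 (hpos _).le
  · intro Q hQ
    simp only [hφ.leftInvOn hQ.1, hinv]
  · intro Q hQ
    simp only [hφ.rightInvOn hQ.1, hinv']
  · rw [hnorm, eq_div_iff (Real.rpow_pos_of_pos (h.pos _ hP.1) k).ne', mul_right_comm,
      ← hNk _ hP.1, hA, h.map_zero, Real.one_rpow, one_mul]

/-- Since `Nᵏ = 1 - k‖ℓ Z‖² + …`, scaling by `√k` makes the unit ball the osculating model. -/
theorem exists_scaled_equiv (ℓ : V ≃L[ℂ] X) (Y : Type*) [NormedAddCommGroup Y]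
    [InnerProductSpace ℂ Y] (hk : 0 < k) :
    ∃ L : (V × Y) ≃L[ℂ] WithLp 2 (X × Y), (∀ P, (L P).snd = P.2) ∧
      (∀ P, ‖(L P).fst‖ ^ 2 = k * ‖ℓ P.1‖ ^ 2) := by
  have hc : ((√k : ℝ) : ℂ) ≠ 0 := Complex.ofReal_ne_zero.2 (Real.sqrt_pos.2 hk).ne'
  let L := ((ℓ.trans (ContinuousLinearEquiv.smulLeft (Units.mk0 _ hc))).prodCongr
    (ContinuousLinearEquiv.refl ℂ Y)).trans (WithLp.prodContinuousLinearEquiv 2 ℂ X Y).symm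
  refine ⟨L, fun P => rfl, fun P => ?_⟩
  change ‖((√k : ℝ) : ℂ) • ℓ P.1‖ ^ 2 = _
  rw [norm_smul, mul_pow, Complex.norm_real, Real.norm_eq_abs, sq_abs, Real.sq_sqrt hk.le]

end HomogeneousBase

end Hartogs

/-! ### Estimates of the squeezing function of Hartogs domains -/

section HartogsSqueezing

namespace HomogeneousBase

variable {V X Y : Type*} [NormedAddCommGroup V] [NormedSpace ℂ V]
  [NormedAddCommGroup X] [InnerProductSpace ℂ X] [NormedAddCommGroup Y] [InnerProductSpace ℂ Y]
  {Ω : Set V} {N : V → ℝ} {ℓ : V ≃L[ℂ] X} {k : ℝ}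

/-- Near the fibre over the origin, the boundary of the Hartogs domain agrees with the unit sphere
to the fourth order, and globally the domain exceeds the unit ball by at most such an error. -/
theorem exists_osculation (h : HomogeneousBase Ω N ℓ) (hk : 0 < k)
    (L : (V × Y) ≃L[ℂ] WithLp 2 (X × Y)) (hL2 : ∀ P, (L P).snd = P.2)
    (hL1 : ∀ P, ‖(L P).fst‖ ^ 2 = k * ‖ℓ P.1‖ ^ 2) :
    ∃ C δ : ℝ, 0 ≤ C ∧ 0 < δ ∧ ∀ e : Y, ‖e‖ = 1 →
      (∀ v ∈ L.symm ⁻¹' hartogs Y Ω N k, ‖(inner ℂ e v.snd : ℂ)‖ < 1 ∧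
        ‖v‖ ^ 2 - 1 ≤ C * (1 - ‖(inner ℂ e v.snd : ℂ)‖) ^ 2) ∧
      (∀ v, ‖v‖ < 1 → 1 - ‖(inner ℂ e v.snd : ℂ)‖ < δ →
        C * (1 - ‖(inner ℂ e v.snd : ℂ)‖) ^ 2 < 1 - ‖v‖ ^ 2 →
          v ∈ L.symm ⁻¹' hartogs Y Ω N k) := by
  obtain ⟨B, hB⟩ := isBounded_iff_forall_norm_le.1
    (ℓ.toContinuousLinearMap.lipschitz.isBounded_image h.isBounded)
  have hℓΩ : IsOpen (ℓ.symm ⁻¹' Ω) := h.isOpen.preimage ℓ.symm.continuous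
  obtain ⟨ρ, hρ, hρΩ⟩ := Metric.isOpen_iff.1 hℓΩ 0 (by simpa using h.zero_mem)
  have hB0 : 0 ≤ B := (norm_nonneg _).trans (hB _ ⟨0, h.zero_mem, rfl⟩)
  have hR : 0 ≤ k * B ^ 2 := by positivity
  have hC : 0 ≤ 8 / k := by positivity
  -- With `q = k‖ℓ Z‖²`, the first term of `C` serves the outer inclusion and `8 / k` the inner one.
  -- The bounds on `δ` ensure `q ≤ k / 2`, as `one_sub_le_rpow` requires, and `‖ℓ Z‖ < ρ`, so that
  -- `Z ∈ Ω`.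
  refine ⟨4 * (1 + k * B ^ 2) ^ 2 + 8 / k, min (k / 4) (k * ρ ^ 2 / 2), by positivity,
    by positivity, fun e he => ⟨?_, ?_⟩⟩
  · intro v hv
    obtain ⟨P, rfl⟩ := L.surjective v
    rw [mem_preimage, L.symm_apply_apply] at hv
    rw [WithLp.prod_norm_sq_eq_of_L2, hL1, hL2]
    have h1 := h.norm_snd_lt_one hk hv
    have h2 : ‖(inner ℂ e P.2 : ℂ)‖ ≤ ‖P.2‖ := by
      simpa [he] using norm_inner_le_norm (𝕜 := ℂ) e P.2
    refine ⟨h2.trans_lt h1, ?_⟩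
    have h3 := hv.2.trans_le (h.rpow_le hk hv.1)
    have h4 : k * ‖ℓ P.1‖ ^ 2 ≤ k * B ^ 2 := by
      have := hB _ ⟨P.1, hv.1, rfl⟩
      gcongr
      exact this
    have hq : 0 ≤ k * ‖ℓ P.1‖ ^ 2 := by positivity
    have h5 := h3.trans_le (exp_neg_le_inv hq)
    generalize k * ‖ℓ P.1‖ ^ 2 = q at *
    generalize k * B ^ 2 = R at *
    generalize ‖(inner ℂ e P.2 : ℂ)‖ = a at *
    have hq1 : 0 < 1 + q := by linarith
    have h6 : (1 + q) * ‖P.2‖ ^ 2 < 1 := by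
      rwa [← one_div, lt_div_iff₀ hq1, mul_comm] at h5
    -- Boundedness of `Ω` turns `(1 + q)‖W‖² < 1` into a linear bound for `q` by `1 - a`, valid on
    -- the whole domain.
    have h7 : q ≤ 2 * (1 + R) * (1 - a) := by
      have h8 : q ≤ (1 + q) * (1 - ‖P.2‖ ^ 2) := by linarith
      have h9 : 1 - ‖P.2‖ ^ 2 ≤ 2 * (1 - a) := by nlinarith [norm_nonneg P.2]
      have h10 : (1 + q) * (1 - ‖P.2‖ ^ 2) ≤ (1 + R) * (2 * (1 - a)) := by
        gcongr
        nlinarith [norm_nonneg P.2]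
      linarith
    have h8 : q + ‖P.2‖ ^ 2 - 1 ≤ q ^ 2 := by
      have : (1 + q) * (q + ‖P.2‖ ^ 2 - 1) ≤ (1 + q) * q ^ 2 := by nlinarith
      exact le_of_mul_le_mul_left this hq1
    have h9 : q ^ 2 ≤ (2 * (1 + R) * (1 - a)) ^ 2 := pow_le_pow_left₀ hq h7 2
    have h10 : 0 ≤ 8 / k * (1 - a) ^ 2 := by positivity
    calc q + ‖P.2‖ ^ 2 - 1 ≤ (2 * (1 + R) * (1 - a)) ^ 2 := h8.trans h9
      _ ≤ (2 * (1 + R) * (1 - a)) ^ 2 + 8 / k * (1 - a) ^ 2 := by linarith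
      _ = _ := by ring
  · intro v hv1 hvδ hvC
    obtain ⟨P, rfl⟩ := L.surjective v
    rw [mem_preimage, L.symm_apply_apply]
    rw [hL2] at hvδ hvC
    have h2 : ‖(inner ℂ e P.2 : ℂ)‖ ≤ ‖P.2‖ := by
      simpa [he] using norm_inner_le_norm (𝕜 := ℂ) e P.2
    have hn := WithLp.prod_norm_sq_eq_of_L2 (L P)
    rw [hL1, hL2] at hn
    have hq : 0 ≤ k * ‖ℓ P.1‖ ^ 2 := by positivity
    have hv2 : ‖L P‖ ^ 2 < 1 := (sq_lt_one_iff₀ (norm_nonneg _)).2 hv1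
    -- Inside the ball, `q < 1 - ‖W‖² ≤ 1 - a² ≤ 2(1 - a)`.
    have h3 : k * ‖ℓ P.1‖ ^ 2 ≤ 2 * (1 - ‖(inner ℂ e P.2 : ℂ)‖) := by
      have : ‖(inner ℂ e P.2 : ℂ)‖ ^ 2 ≤ ‖P.2‖ ^ 2 := by gcongr
      nlinarith [sq_nonneg (1 - ‖(inner ℂ e P.2 : ℂ)‖)]
    have hδ1 := hvδ.trans_le (min_le_left _ _)
    have hδ2 := hvδ.trans_le (min_le_right _ _)
    have hZ : P.1 ∈ Ω := by
      have h4 : k * ‖ℓ P.1‖ ^ 2 < k * ρ ^ 2 := by linarith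
      have h5 := lt_of_pow_lt_pow_left₀ 2 hρ.le (lt_of_mul_lt_mul_left h4 hk.le)
      simpa using hρΩ (mem_ball_zero_iff.2 h5)
    refine ⟨hZ, ?_⟩
    have h4 : k * ‖ℓ P.1‖ ^ 2 ≤ k / 2 := by linarith
    have h5 := one_sub_le_rpow (x := N P.1) hk h4 (by
      rw [mul_div_cancel_left₀ _ hk.ne']; exact h.lower _ hZ)
    refine lt_of_lt_of_le ?_ h5
    generalize k * ‖ℓ P.1‖ ^ 2 = q at *
    generalize ‖(inner ℂ e P.2 : ℂ)‖ = a at *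
    have h6 : q ^ 2 ≤ (2 * (1 - a)) ^ 2 := pow_le_pow_left₀ hq h3 2
    have h7 : 2 / k * q ^ 2 ≤ 2 / k * (2 * (1 - a)) ^ 2 := by gcongr
    have h8 : 2 / k * (2 * (1 - a)) ^ 2 = 8 / k * (1 - a) ^ 2 := by ring
    have h9 : 0 ≤ 4 * (1 + k * B ^ 2) ^ 2 * (1 - a) ^ 2 := by positivity
    rw [hn] at hvC
    linarith

variable [FiniteDimensional ℂ V] [FiniteDimensional ℂ Y] [Nontrivial Y]

/-- The point is moved to `(0, W)`, that is to `‖W‖ e'` with `e'` on the sphere, and the ball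
automorphism with `w = ‖W‖` carries it to the origin. The constants of `exists_osculation` do not
depend on `e`, so `τ` is uniform. -/
theorem exists_lower_bound_near_boundary (h : HomogeneousBase Ω N ℓ) (hk : 0 < k) {ε : ℝ}
    (hε : 0 < ε) :
    ∃ τ, 0 < τ ∧ ∀ P ∈ hartogs Y Ω N k, 1 - τ < ‖P.2‖ ^ 2 / N P.1 ^ k →
      (1 - ε) / (1 + ε) ≤ squeezingFunction (hartogs Y Ω N k) P := by
  obtain ⟨L, hL2, hL1⟩ := exists_scaled_equiv ℓ Y hk
  obtain ⟨C, δ, hC, hδ, H⟩ := h.exists_osculation hk L hL2 hL1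
  have hfin : FiniteDimensional ℂ (WithLp 2 (X × Y)) := L.toLinearEquiv.finiteDimensional
  -- The three bounds on `1 - ‖W‖²` give `W ≠ 0` and the two smallness conditions of
  -- `ballMap_image_between`.
  refine ⟨min 1 (min (ε / (C + 1)) (ε * δ ^ 2)), by positivity, fun P hP hPτ => ?_⟩
  obtain ⟨f, g, W, hf, hfP, hW⟩ := h.exists_equiv_hartogs hP
  have hfP' : ((0 : V), W) ∈ hartogs Y Ω N k := hfP ▸ hf.mapsTo hP
  have hW1 : ‖W‖ < 1 := h.norm_snd_lt_one hk hfP'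
  rw [← hW, sub_lt_comm, lt_min_iff, lt_min_iff, lt_div_iff₀ (by linarith)] at hPτ
  obtain ⟨hτ0, hτ1, hτ2⟩ := hPτ
  have hW0 : 0 < ‖W‖ := by
    by_contra! h0
    have := le_antisymm h0 (norm_nonneg _)
    rw [this] at hτ0
    simp at hτ0
  have hWc : ((‖W‖ : ℝ) : ℂ) ≠ 0 := Complex.ofReal_ne_zero.2 hW0.ne'
  set e : Y := ((‖W‖ : ℝ) : ℂ)⁻¹ • W with he_def
  have he : ‖e‖ = 1 := by
    rw [he_def, norm_smul, norm_inv, Complex.norm_real, norm_norm, inv_mul_cancel₀ hW0.ne']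
  have heW : ((‖W‖ : ℝ) : ℂ) • e = W := by rw [he_def, smul_smul, mul_inv_cancel₀ hWc, one_smul]
  let e' : WithLp 2 (X × Y) := WithLp.toLp 2 (0, e)
  have he' : ‖e'‖ = 1 := by
    rw [← sq_eq_sq₀ (norm_nonneg _) zero_le_one, WithLp.prod_norm_sq_eq_of_L2]
    simp [e', he]
  have hin : ∀ v : WithLp 2 (X × Y), inner ℂ e' v = (inner ℂ e v.snd : ℂ) := fun v => by
    rw [WithLp.prod_inner_apply]
    simp [e']
  have hmap : L (0, W) = ((‖W‖ : ℝ) : ℂ) • e' := by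
    refine (WithLp.ofLp_injective 2) (Prod.ext ?_ ?_)
    · have := hL1 (0, W)
      simp only [_root_.map_zero, norm_zero] at this
      have h0 : (L (0, W)).fst = 0 := by
        rw [← norm_eq_zero]; simpa using this
      change (L (0, W)).fst = _
      rw [h0]; simp [e']
    · change (L (0, W)).snd = _
      rw [hL2]
      exact heW.symm
  obtain ⟨H1, H2⟩ := H e he
  obtain ⟨K1, K2, K3⟩ := ballMap_image_between (w := ‖W‖) (C := C) (δ := δ) (ε := ε)
    (D := L.symm ⁻¹' hartogs Y Ω N k) he' hδ hε hC
    (by simpa only [hin] using H1) (by simpa only [hin] using H2)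
    hW0.le hW1 (by nlinarith) hτ2
  have hopen : IsOpen (L.symm ⁻¹' hartogs Y Ω N k) :=
    (h.isOpen_hartogs hk).preimage L.symm.continuous
  refine div_le_squeezingFunction L.toLinearEquiv.finrank_eq.symm
    ((hf.trans (.of_continuousLinearEquiv L _)).trans K1) (isOpen_ballMap_image hopen) ?_
    (by linarith) K2 K3
  simp only [Function.comp_apply]
  rw [hfP, hmap, ballMap_apply_center he']

/-- The moved points lie in a compact subset of the open domain, so balls of one radius `ρ` fit
around all of them. Translation, a fixed linear isomorphism and boundedness of the domain then
compare with Euclidean balls. -/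
theorem exists_lower_bound_away_from_boundary (h : HomogeneousBase Ω N ℓ) (hk : 0 < k) {τ : ℝ}
    (hτ : 0 < τ) :
    ∃ c, 0 < c ∧ ∀ P ∈ hartogs Y Ω N k, ‖P.2‖ ^ 2 / N P.1 ^ k ≤ 1 - τ →
      c ≤ squeezingFunction (hartogs Y Ω N k) P := by
  obtain ⟨L, -, -⟩ := exists_scaled_equiv ℓ Y hk
  have hfin : FiniteDimensional ℂ (WithLp 2 (X × Y)) := L.toLinearEquiv.finiteDimensional
  have hopen := h.isOpen_hartogs (Y := Y) hk
  have hcomp : IsCompact (({0} : Set V) ×ˢ Metric.closedBall (0 : Y) (√(1 - τ))) :=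
    isCompact_singleton.prod (isCompact_closedBall 0 _)
  obtain ⟨ρ, hρ, hρD⟩ := hcomp.exists_thickening_subset_open hopen (by
    rintro ⟨Z, W⟩ ⟨hZ, hW⟩
    obtain rfl : Z = 0 := hZ
    refine ⟨h.zero_mem, ?_⟩
    rw [h.map_zero, Real.one_rpow]
    rw [mem_closedBall_zero_iff] at hW
    have h1 : √(1 - τ) < 1 := by
      rw [Real.sqrt_lt' one_pos]; linarith
    have h2 := hW.trans_lt h1
    exact (sq_lt_one_iff₀ (norm_nonneg _)).2 h2)
  obtain ⟨R, hR, hDR⟩ := (h.isBounded_hartogs (Y := Y) hk).subset_ball_lt 0 0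
  obtain ⟨a, ha0, ha⟩ : ∃ a : ℝ, 0 ≤ a ∧ ∀ x, ‖L x‖ ≤ a * ‖x‖ :=
    ⟨‖(L : V × Y →L[ℂ] WithLp 2 (X × Y))‖, by positivity, L.toContinuousLinearMap.le_opNorm⟩
  obtain ⟨b, hb0, hb⟩ : ∃ b : ℝ, 0 ≤ b ∧ ∀ y, ‖L.symm y‖ ≤ b * ‖y‖ :=
    ⟨‖(L.symm : WithLp 2 (X × Y) →L[ℂ] V × Y)‖, by positivity,
      L.symm.toContinuousLinearMap.le_opNorm⟩
  have hr : 0 < ρ / (b + 1) := by positivity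
  have hR' : 0 < (a + 1) * (R + R) := by positivity
  -- `R + R` bounds the distance between two points of the domain; `a` and `b` bound the distortion
  -- by `L` and its inverse, and adding `1` keeps the factors positive.
  refine ⟨ρ / (b + 1) / ((a + 1) * (R + R)), by positivity, fun P hP hPτ => ?_⟩
  obtain ⟨f, g, W, hf, hfP, hW⟩ := h.exists_equiv_hartogs hP
  have hfP' : ((0 : V), W) ∈ hartogs Y Ω N k := hfP ▸ hf.mapsTo hP
  have hWτ : ‖W‖ ≤ √(1 - τ) := Real.le_sqrt_of_sq_le (hW ▸ hPτ)
  have heq := (hf.trans (.of_affine (c := 1) one_ne_zero ((0 : V), W) _)).trans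
    (.of_continuousLinearEquiv L _)
  refine div_le_squeezingFunction L.toLinearEquiv.finrank_eq.symm heq
    ((hopen.preimage (by fun_prop)).preimage L.symm.continuous) ?_ hR' ?_ ?_
  · simp [hfP]
  · rw [← heq.image_eq]
    rintro _ ⟨Q, hQ, rfl⟩
    rw [mem_ball_zero_iff]
    change ‖L ((1 : ℂ) • (f Q - (0, W)))‖ < _
    have h1 := ha ((1 : ℂ) • (f Q - (0, W)))
    have h2 : ‖(1 : ℂ) • (f Q - (0, W))‖ < R + R := by
      rw [one_smul]
      exact (norm_sub_le _ _).trans_lt (add_lt_add (mem_ball_zero_iff.1 (hDR (hf.mapsTo hQ)))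
        (mem_ball_zero_iff.1 (hDR hfP')))
    refine h1.trans_lt ?_
    nlinarith [norm_nonneg ((1 : ℂ) • (f Q - (0, W)))]
  · intro y hy
    rw [mem_ball_zero_iff, lt_div_iff₀ (by positivity)] at hy
    refine hρD (Metric.mem_thickening_iff.2 ⟨(0, W), ⟨rfl, mem_closedBall_zero_iff.2 hWτ⟩, ?_⟩)
    rw [dist_eq_norm]
    change ‖(1 : ℂ)⁻¹ • L.symm y + (0, W) - (0, W)‖ < ρ
    rw [inv_one, one_smul, add_sub_cancel_right]
    have h1 := hb y
    refine lt_of_le_of_lt h1 ?_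
    nlinarith [norm_nonneg y]

/-- The condition `W₀ ≠ 0` forces `N(Z₀) > 0`, so `Z₀` lies in `Ω` itself and the invariant ratio is
continuous at `P₀` with value at least `1`. The upper bound is `squeezingFunction_le_one`. -/
theorem tendsto_squeezingFunction (h : HomogeneousBase Ω N ℓ) (hk : 0 < k) {P₀ : V × Y}
    (hP₀ : P₀ ∈ frontier (hartogs Y Ω N k)) (hW₀ : P₀.2 ≠ 0) :
    Tendsto (squeezingFunction (hartogs Y Ω N k)) (𝓝[hartogs Y Ω N k] P₀) (𝓝 1) := by
  have hcl := frontier_subset_closure hP₀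
  have hle : P₀ ∈ {P : V × Y | ‖P.2‖ ^ 2 ≤ N P.1 ^ k} :=
    closure_minimal (fun P hP => hP.2.le) (isClosed_le (by fun_prop) (h.continuous_rpow hk)) hcl
  have hN0 : P₀ ∈ {P : V × Y | 0 ≤ N P.1} :=
    closure_minimal (fun P hP => (h.pos _ hP.1).le)
      (isClosed_le continuous_const (h.continuous.comp continuous_fst)) hcl
  have hNk : 0 < N P₀.1 ^ k := lt_of_lt_of_le (by have := norm_pos_iff.2 hW₀; positivity) hle
  have hN : 0 < N P₀.1 := by
    refine lt_of_le_of_ne hN0 fun h0 => ?_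
    rw [← h0, Real.zero_rpow hk.ne'] at hNk
    exact lt_irrefl _ hNk
  have hZ : P₀.1 ∈ Ω := by
    refine h.mem_of_closure _ ?_ hN
    exact closure_mono (image_subset_iff.2 fun P hP => hP.1)
      (image_closure_subset_closure_image continuous_fst ⟨P₀, hcl, rfl⟩)
  have hratio : 1 ≤ ‖P₀.2‖ ^ 2 / N P₀.1 ^ k := by
    rw [one_le_div hNk]
    by_contra! hlt
    have : P₀ ∈ interior (hartogs Y Ω N k) := by
      rw [(h.isOpen_hartogs hk).interior_eq]; exact ⟨hZ, hlt⟩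
    exact hP₀.2 this
  have hcont : Tendsto (fun P : V × Y => ‖P.2‖ ^ 2 / N P.1 ^ k) (𝓝[hartogs Y Ω N k] P₀)
      (𝓝 (‖P₀.2‖ ^ 2 / N P₀.1 ^ k)) :=
    (ContinuousAt.div (by fun_prop) (h.continuous_rpow hk).continuousAt hNk.ne').mono_left
      nhdsWithin_le_nhds
  refine tendsto_order.2 ⟨fun c hc => ?_, fun c hc => ?_⟩
  · obtain ⟨ε, hε, hcε⟩ : ∃ ε : ℝ, 0 < ε ∧ c < (1 - ε) / (1 + ε) := by
      have h1 : ContinuousAt (fun ε : ℝ => (1 - ε) / (1 + ε)) 0 :=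
        ContinuousAt.div (by fun_prop) (by fun_prop) (by norm_num)
      have h2 : ∀ᶠ ε : ℝ in 𝓝[>] 0, c < (1 - ε) / (1 + ε) :=
        (h1.eventually_const_lt (by simpa using hc)).filter_mono nhdsWithin_le_nhds
      obtain ⟨ε, h3, h4⟩ := (h2.and self_mem_nhdsWithin).exists
      exact ⟨ε, h4, h3⟩
    obtain ⟨τ, hτ, H⟩ := h.exists_lower_bound_near_boundary (Y := Y) hk hε
    filter_upwards [hcont.eventually_const_lt (by linarith : 1 - τ < _), self_mem_nhdsWithin]
      with P hP hPD
    exact hcε.trans_le (H P hPD hP)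
  · exact .of_forall fun P => (squeezingFunction_le_one _ P).trans_lt hc

theorem isHomogeneousRegular (h : HomogeneousBase Ω N ℓ) (hk : 0 < k) :
    IsHomogeneousRegular (hartogs Y Ω N k) where
  isOpen := h.isOpen_hartogs hk
  isConnected := h.isConnected_hartogs
  isBounded := h.isBounded_hartogs hk
  bound := by
    obtain ⟨τ, hτ, H₁⟩ := h.exists_lower_bound_near_boundary (Y := Y) hk one_half_pos
    obtain ⟨c, hc, H₂⟩ := h.exists_lower_bound_away_from_boundary (Y := Y) hk hτ
    refine ⟨min c ((1 - 1 / 2) / (1 + 1 / 2)), by positivity, fun P hP => ?_⟩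
    rcases lt_or_ge (1 - τ) (‖P.2‖ ^ 2 / N P.1 ^ k) with h1 | h1
    · exact (min_le_right _ _).trans (H₁ P hP h1)
    · exact (min_le_left _ _).trans (H₂ P hP h1)

end HomogeneousBase

end HartogsSqueezing

/-! ### Holomorphic matrix functions and logarithms -/

section MatrixCalculus

attribute [local instance] Matrix.frobeniusNormedRing Matrix.frobeniusNormedAlgebra

variable {E : Type*} [NormedAddCommGroup E] [NormedSpace ℂ E] {a b c : ℕ} {s : Set E}

theorem DifferentiableOn.matrix_mul
    {f : E → Matrix (Fin a) (Fin b) ℂ} {g : E → Matrix (Fin b) (Fin c) ℂ}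
    (hf : DifferentiableOn ℂ f s) (hg : DifferentiableOn ℂ g s) :
    DifferentiableOn ℂ (fun x => f x * g x) s := by
  have h : IsBoundedBilinearMap ℂ
      (fun p : Matrix (Fin a) (Fin b) ℂ × Matrix (Fin b) (Fin c) ℂ => p.1 * p.2) :=
    { add_left := fun _ _ _ => Matrix.add_mul _ _ _
      smul_left := fun _ _ _ => Matrix.smul_mul _ _ _
      add_right := fun _ _ _ => Matrix.mul_add _ _ _
      smul_right := fun _ _ _ => Matrix.mul_smul _ _ _
      bound := ⟨1, one_pos, fun A B => by simpa using Matrix.frobenius_norm_mul A B⟩ }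
  exact h.differentiable.comp_differentiableOn (hf.prodMk hg)

theorem DifferentiableOn.matrix_inv {f : E → Matrix (Fin a) (Fin a) ℂ}
    (hf : DifferentiableOn ℂ f s) (h : ∀ x ∈ s, IsUnit (f x).det) :
    DifferentiableOn ℂ (fun x => (f x)⁻¹) s := by
  intro x hx
  have h1 := (differentiableAt_inverse (𝕜 := ℂ)
    ((Matrix.isUnit_iff_isUnit_det (f x)).2 (h x hx))).comp_differentiableWithinAt x (hf x hx)
  have h2 : (fun x => (f x)⁻¹) = fun x => Ring.inverse (f x) :=
    funext fun x => Matrix.nonsing_inv_eq_ringInverse _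
  rw [h2]
  exact h1

theorem differentiable_matrix_entry (i : Fin a) (j : Fin b) :
    Differentiable ℂ fun M : Matrix (Fin a) (Fin b) ℂ => M i j :=
  (LinearMap.toContinuousLinearMap
    (Matrix.entryLinearMap ℂ ℂ i j : Matrix (Fin a) (Fin b) ℂ →ₗ[ℂ] ℂ)).differentiable

theorem DifferentiableOn.matrix_det {f : E → Matrix (Fin a) (Fin a) ℂ}
    (hf : DifferentiableOn ℂ f s) : DifferentiableOn ℂ (fun x => (f x).det) s := by
  have h : ∀ i j, DifferentiableOn ℂ (fun x => f x i j) s := fun i j =>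
    (differentiable_matrix_entry i j).comp_differentiableOn hf
  simp only [Matrix.det_apply']
  refine .fun_sum fun σ _ => .const_mul (fun x hx => ?_) _
  exact (HasFDerivWithinAt.finsetProd
    fun i _ => (h (σ i) i x hx).hasFDerivWithinAt).differentiableWithinAt

/-- A nowhere vanishing holomorphic function on a star-shaped open set has a holomorphic logarithm.
-/
theorem exists_holomorphic_log {Ω : Set E} (hΩ : IsOpen Ω) (h0 : 0 ∈ Ω)
    (hs : ∀ Z ∈ Ω, ∀ t : ℝ, 0 ≤ t → t ≤ 1 → (t : ℂ) • Z ∈ Ω) {p : E → ℂ}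
    (hp : DifferentiableOn ℂ p Ω) (hp0 : ∀ Z ∈ Ω, p Z ≠ 0) :
    ∃ q : E → ℂ, DifferentiableOn ℂ q Ω ∧ ∀ Z ∈ Ω, Complex.exp (q Z) = p Z := by
  have hstar : StarConvex ℝ 0 Ω := starConvex_zero_iff.2 fun Z hZ t ht0 ht1 => by
    simpa using hs Z hZ t ht0 ht1
  have hsc : IsSimplyConnected Ω := by
    have := hstar.contractibleSpace ⟨0, h0⟩
    exact inferInstanceAs (SimplyConnectedSpace Ω)
  obtain ⟨q, hqc, hq⟩ := Complex.exists_continuousOn_eqOn_exp_comp hsc hΩ hp.continuousOn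
    (by rintro ⟨Z, hZ, h⟩; exact hp0 Z hZ h)
  refine ⟨q, fun Z hZ => ?_, fun Z hZ => hq hZ⟩
  have hqZ : ContinuousAt q Z := hqc.continuousAt (hΩ.mem_nhds hZ)
  -- Near `Z` the continuous logarithm equals the principal branch of `log (p z / p Z)` plus a
  -- constant, so it is holomorphic.
  have hlog : DifferentiableAt ℂ (fun z => Complex.log (p z / p Z) + q Z) Z := by
    have hpZ : DifferentiableAt ℂ p Z := hp.differentiableAt (hΩ.mem_nhds hZ)
    simp only [div_eq_mul_inv]
    refine ((hpZ.mul_const _).clog ?_).add_const _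
    rw [mul_inv_cancel₀ (hp0 Z hZ)]; simp
  refine (hlog.congr_of_eventuallyEq ?_).differentiableWithinAt
  have him : ∀ᶠ z in 𝓝 Z, |(q z - q Z).im| < Real.pi := by
    have : ContinuousAt (fun z => |(q z - q Z).im|) Z :=
      (Complex.continuous_im.continuousAt.comp (hqZ.sub continuousAt_const)).abs
    exact this.eventually_lt_const (by simpa using Real.pi_pos)
  filter_upwards [him, hΩ.mem_nhds hZ] with z hz hzΩ
  have h1 : p z / p Z = Complex.exp (q z - q Z) := by
    rw [Complex.exp_sub]
    exact congrArg₂ _ (hq hzΩ).symm (hq hZ).symm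
  rw [h1, Complex.log_exp (abs_lt.1 hz).1 (abs_lt.1 hz).2.le]
  ring

end MatrixCalculus

/-! ### The matrix ball and its generic norm -/

section MatrixBall

open ClassicalSeries

variable {a b : ℕ}

/-- The unit ball for the operator norm in the space of `a × b` matrices. -/
def matrixBall (a b : ℕ) : Set (Matrix (Fin a) (Fin b) ℂ) :=
  {Z | (hermitianDefect Z).PosDef}

theorem isHermitian_hermitianDefect (Z : Matrix (Fin a) (Fin b) ℂ) :
    (hermitianDefect Z).IsHermitian := by
  simp [hermitianDefect, Matrix.IsHermitian]

theorem continuous_hermitianDefect :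
    Continuous (hermitianDefect : Matrix (Fin a) (Fin b) ℂ → _) := by
  unfold hermitianDefect; fun_prop

theorem mem_matrixBall_iff {Z : Matrix (Fin a) (Fin b) ℂ} :
    Z ∈ matrixBall a b ↔ ∀ v ≠ 0, 0 < (star v ⬝ᵥ (hermitianDefect Z *ᵥ v)).re := by
  constructor
  · intro h v hv
    exact Matrix.PosDef.re_dotProduct_pos h hv
  · intro h
    refine .of_dotProduct_mulVec_pos (isHermitian_hermitianDefect Z) fun v hv => ?_
    rw [Complex.lt_def]
    refine ⟨h v hv, ?_⟩
    have := (isHermitian_hermitianDefect Z).im_star_dotProduct_mulVec_self v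
    simpa using this.symm

/-- Positivity of the form need only be tested on the compact unit sphere, where it persists under
small changes of `Z`. -/
theorem isOpen_matrixBall : IsOpen (matrixBall a b) := by
  rw [isOpen_iff_mem_nhds]
  intro Z hZ
  have hK : IsCompact (Metric.sphere (0 : Fin a → ℂ) 1) := isCompact_sphere 0 1
  have hf : Continuous fun x : Matrix (Fin a) (Fin b) ℂ × (Fin a → ℂ) =>
      (star x.2 ⬝ᵥ (hermitianDefect x.1 *ᵥ x.2)).re := by
    have := continuous_hermitianDefect (a := a) (b := b)
    fun_prop
  have h1 := hK.eventually_forall_of_forall_eventually (x₀ := Z)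
    (P := fun Z v => 0 < (star v ⬝ᵥ (hermitianDefect Z *ᵥ v)).re) fun v hv =>
      (hf.continuousAt (x := (Z, v))).eventually_const_lt
        (mem_matrixBall_iff.1 hZ v (by rintro rfl; simp at hv))
  filter_upwards [h1] with Z' h
  rw [mem_matrixBall_iff]
  intro v hv
  have hv' : ‖v‖ ≠ 0 := norm_ne_zero_iff.2 hv
  have h2 := h ((((‖v‖)⁻¹ : ℝ) : ℂ) • v) (by
    rw [mem_sphere_zero_iff_norm, norm_smul, Complex.norm_real, norm_inv, norm_norm,
      inv_mul_cancel₀ hv'])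
  rw [Matrix.mulVec_smul, dotProduct_smul, star_smul, smul_dotProduct, smul_smul, smul_eq_mul,
    ← starRingEnd_apply, Complex.conj_ofReal, ← Complex.ofReal_mul, Complex.re_ofReal_mul] at h2
  exact pos_of_mul_pos_right h2 (mul_self_nonneg _)

/-- A limit of positive definite forms is semidefinite, and a nonzero determinant makes it definite.
-/
theorem mem_matrixBall_of_closure {Z : Matrix (Fin a) (Fin b) ℂ}
    (hZ : Z ∈ closure (matrixBall a b)) (hN : 0 < (hermitianDefect Z).det.re) :
    Z ∈ matrixBall a b := by
  have hsemi : (hermitianDefect Z).PosSemidef := by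
    refine .of_dotProduct_mulVec_nonneg (isHermitian_hermitianDefect Z) fun v => ?_
    rw [Complex.le_def]
    refine ⟨?_, ?_⟩
    · have hf : Continuous fun Z : Matrix (Fin a) (Fin b) ℂ =>
          (star v ⬝ᵥ (hermitianDefect Z *ᵥ v)).re := by
        have := continuous_hermitianDefect (a := a) (b := b)
        fun_prop
      have : Z ∈ {Z : Matrix (Fin a) (Fin b) ℂ | 0 ≤ (star v ⬝ᵥ (hermitianDefect Z *ᵥ v)).re} :=
        closure_minimal (fun Z' hZ' => Matrix.PosSemidef.re_dotProduct_nonneg hZ'.posSemidef v)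
          (isClosed_le continuous_const hf) hZ
      exact this
    · have := (isHermitian_hermitianDefect Z).im_star_dotProduct_mulVec_self v
      simpa using this.symm
  refine hsemi.posDef_iff_det_ne_zero.2 fun h => ?_
  rw [h] at hN
  simp at hN

theorem smul_mem_matrixBall {Z : Matrix (Fin a) (Fin b) ℂ} (hZ : Z ∈ matrixBall a b) {t : ℝ}
    (ht0 : 0 ≤ t) (ht1 : t ≤ 1) : (t : ℂ) • Z ∈ matrixBall a b := by
  rcases ht1.eq_or_lt with rfl | ht1
  · simpa using hZ
  -- The defect becomes a convex combination of `1` and the original defect.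
  have h : hermitianDefect ((t : ℂ) • Z) =
      ((1 - t ^ 2 : ℝ) : ℂ) • (1 : Matrix (Fin a) (Fin a) ℂ) +
        ((t ^ 2 : ℝ) : ℂ) • hermitianDefect Z := by
    simp only [hermitianDefect, Matrix.conjTranspose_smul, Matrix.smul_mul, Matrix.mul_smul,
      smul_smul, RCLike.star_def, Complex.conj_ofReal, smul_sub, ← sq]
    rw [Complex.ofReal_sub, Complex.ofReal_one, sub_smul, one_smul, Complex.ofReal_pow]
    abel
  change (hermitianDefect ((t : ℂ) • Z)).PosDef
  rw [h]
  refine Matrix.PosDef.add_posSemidef (Matrix.PosDef.one.smul ?_) (hZ.posSemidef.smul ?_)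
  · exact_mod_cast by nlinarith
  · exact_mod_cast by positivity

theorem zero_mem_matrixBall : (0 : Matrix (Fin a) (Fin b) ℂ) ∈ matrixBall a b := by
  simpa [matrixBall, hermitianDefect] using Matrix.PosDef.one

theorem norm_sq_eq_trace (Z : Matrix (Fin a) (Fin b) ℂ) :
    (‖Z‖ ^ 2 : ℝ) = ((Z * Zᴴ).trace).re := by
  rw [Matrix.frobenius_norm_def, ← Real.rpow_natCast, ← Real.rpow_mul (by positivity)]
  norm_num
  simp only [Matrix.trace, Matrix.mul_apply, Matrix.diag_apply, Matrix.conjTranspose_apply,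
    Complex.re_sum]
  refine Finset.sum_congr rfl fun i _ => Finset.sum_congr rfl fun j _ => ?_
  rw [RCLike.star_def, Complex.mul_conj, Complex.ofReal_re, Complex.normSq_eq_norm_sq]

theorem one_sub_sum_le_prod {ι : Type*} (s : Finset ι) (x : ι → ℝ) (h0 : ∀ i, 0 ≤ x i)
    (h1 : ∀ i, x i ≤ 1) : 1 - ∑ i ∈ s, (1 - x i) ≤ ∏ i ∈ s, x i := by
  classical
  induction s using Finset.induction_on with
  | empty => simp
  | insert i s hi ih =>
    rw [Finset.sum_insert hi, Finset.prod_insert hi]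
    have h2 : ∏ i ∈ s, x i ≤ 1 := Finset.prod_le_one (fun i _ => h0 i) fun i _ => h1 i
    nlinarith [h0 i, h1 i]

/-- The eigenvalues `λ` of `1 - Z Zᴴ` lie in `(0, 1]` and `‖Z‖² = ∑ (1 - λ)`. The bounds are the
Weierstrass product inequality and the product of `λ ≤ exp (λ - 1)`. -/
theorem det_hermitianDefect_bounds {Z : Matrix (Fin a) (Fin b) ℂ} (hZ : Z ∈ matrixBall a b) :
    1 - ‖Z‖ ^ 2 ≤ (hermitianDefect Z).det.re ∧
      (hermitianDefect Z).det.re ≤ Real.exp (-‖Z‖ ^ 2) := by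
  have hH := isHermitian_hermitianDefect Z
  have hpos : ∀ i, 0 < hH.eigenvalues i := Matrix.PosDef.eigenvalues_pos hZ
  have hdet : (hermitianDefect Z).det.re = ∏ i, hH.eigenvalues i := by
    rw [hH.det_eq_prod_eigenvalues]
    simp [← Complex.ofReal_prod]
  have htr : ‖Z‖ ^ 2 = ∑ i, (1 - hH.eigenvalues i) := by
    have h1 : Z * Zᴴ = 1 - hermitianDefect Z := by simp [hermitianDefect]
    rw [norm_sq_eq_trace, h1, Matrix.trace_sub, hH.trace_eq_sum_eigenvalues]
    simp [Finset.sum_sub_distrib]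
  have hle : ∀ i, hH.eigenvalues i ≤ 1 := by
    intro i
    rw [hH.eigenvalues_eq]
    generalize hv : (WithLp.ofLp (hH.eigenvectorBasis i)) = v
    have h1 : (star v ⬝ᵥ v) = 1 := by
      have := hH.eigenvectorBasis.orthonormal.1 i
      rw [← hv, ← dotProduct_comm, ← EuclideanSpace.inner_eq_star_dotProduct,
        inner_self_of_norm_one this]
    have h2 : star v ⬝ᵥ (Z * Zᴴ) *ᵥ v = star (Zᴴ *ᵥ v) ⬝ᵥ (Zᴴ *ᵥ v) := by
      rw [← Matrix.mulVec_mulVec, Matrix.dotProduct_mulVec, Matrix.star_mulVec,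
        Matrix.conjTranspose_conjTranspose]
    rw [hermitianDefect, Matrix.sub_mulVec, Matrix.one_mulVec, dotProduct_sub, h1, h2]
    have h3 := dotProduct_star_self_nonneg (star (Zᴴ *ᵥ v))
    rw [star_star, dotProduct_comm] at h3
    have := (Complex.le_def.1 h3).1
    simpa using this
  rw [hdet, htr]
  refine ⟨one_sub_sum_le_prod _ _ (fun i => (hpos i).le) hle, ?_⟩
  rw [← Finset.sum_neg_distrib, Real.exp_sum]
  refine Finset.prod_le_prod (fun i _ => (hpos i).le) fun i _ => ?_
  have := Real.add_one_le_exp (-(1 - hH.eigenvalues i))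
  linarith

theorem isBounded_matrixBall : Bornology.IsBounded (matrixBall a b) := by
  refine isBounded_iff_forall_norm_le.2 ⟨√a, fun Z hZ => Real.le_sqrt_of_sq_le ?_⟩
  have h1 : Z * Zᴴ = 1 - hermitianDefect Z := by simp [hermitianDefect]
  have h2 : 0 ≤ (hermitianDefect Z).trace := Matrix.PosSemidef.trace_nonneg hZ.posSemidef
  rw [norm_sq_eq_trace, h1, Matrix.trace_sub]
  have := (Complex.le_def.1 h2).1
  simpa using this

theorem det_hermitianDefect_pos {Z : Matrix (Fin a) (Fin b) ℂ} (hZ : Z ∈ matrixBall a b) :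
    0 < (hermitianDefect Z).det.re := by
  have := Matrix.PosDef.det_pos hZ
  exact (Complex.lt_def.1 this).1

end MatrixBall

/-! ### Möbius automorphisms of the matrix ball -/

section Mobius

open ClassicalSeries

variable {a b : ℕ} {A Z : Matrix (Fin a) (Fin b) ℂ} {P : Matrix (Fin a) (Fin a) ℂ}
  {Q : Matrix (Fin b) (Fin b) ℂ}

/-- The push-through rule `(1 - AB)⁻¹ A = A (1 - BA)⁻¹`, the rewriting rule behind the identities
below. -/
theorem defect_inv_mul {B : Matrix (Fin b) (Fin a) ℂ} (hP : (1 - A * B) * P = 1)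
    (hQ : (1 - B * A) * Q = 1) : P * A = A * Q := by
  have hP' : P * (1 - A * B) = 1 := mul_eq_one_comm.1 hP
  calc P * A = P * (A * ((1 - B * A) * Q)) := by rw [hQ, Matrix.mul_one]
    _ = P * (1 - A * B) * (A * Q) := by
      simp only [Matrix.mul_sub, Matrix.sub_mul, Matrix.mul_assoc, Matrix.one_mul, Matrix.mul_one]
    _ = A * Q := by rw [hP', Matrix.one_mul]

theorem mul_defect_inv_mul {B : Matrix (Fin b) (Fin a) ℂ} (hP : (1 - A * B) * P = 1)
    (hQ : (1 - B * A) * Q = 1) : A * (Q * B) = P - 1 := by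
  have hP' : P * (1 - A * B) = 1 := mul_eq_one_comm.1 hP
  rw [← Matrix.mul_assoc, ← defect_inv_mul hP hQ, Matrix.mul_assoc]
  rw [Matrix.mul_sub, Matrix.mul_one] at hP'
  rw [← hP']; abel

/-- Hua's identity. After expansion, the push-through rules bring all words in `A`, `Aᴴ`, `P`, `Q`
to a normal form, where everything cancels except `1 - Z Zᴴ`. -/
theorem defect_identity (hP : (1 - A * Aᴴ) * P = 1) (hQ : (1 - Aᴴ * A) * Q = 1) :
    (1 - Z * Aᴴ) * P * (1 - Z * Aᴴ)ᴴ - (Z - A) * Q * (Z - A)ᴴ = 1 - Z * Zᴴ := by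
  have h1 : ∀ {c : ℕ} (M : Matrix (Fin b) (Fin c) ℂ), P * (A * M) = A * (Q * M) := fun M => by
    rw [← Matrix.mul_assoc, defect_inv_mul hP hQ, Matrix.mul_assoc]
  have h2 : Aᴴ * P = Q * Aᴴ := (defect_inv_mul hQ hP).symm
  have h3 := mul_defect_inv_mul hP hQ
  have h4 : ∀ {c : ℕ} (M : Matrix (Fin b) (Fin c) ℂ), Q * (Aᴴ * (A * M)) = Q * M - M := fun M => by
    rw [← Matrix.mul_assoc Q, ← h2, ← Matrix.mul_assoc, Matrix.mul_assoc Aᴴ,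
      mul_defect_inv_mul hQ hP, Matrix.sub_mul, Matrix.one_mul]
  simp only [Matrix.conjTranspose_sub, Matrix.conjTranspose_mul, Matrix.conjTranspose_one,
    Matrix.conjTranspose_conjTranspose, Matrix.mul_sub, Matrix.sub_mul, Matrix.mul_one,
    Matrix.one_mul, Matrix.mul_assoc, h1, h2, h3, h4]
  abel

/-- Equates the left-handed and right-handed forms of the Möbius map, which transposition
interchanges. -/
theorem defect_intertwining (hP : (1 - A * Aᴴ) * P = 1) (hQ : (1 - Aᴴ * A) * Q = 1) :
    (1 - Z * Aᴴ) * P * (Z - A) = (Z - A) * Q * (1 - Aᴴ * Z) := by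
  have h1 := defect_inv_mul hP hQ
  have h2 : ∀ {c : ℕ} (M : Matrix (Fin a) (Fin c) ℂ), Aᴴ * (P * M) = Q * (Aᴴ * M) := fun M => by
    rw [← Matrix.mul_assoc, ← defect_inv_mul hQ hP, Matrix.mul_assoc]
  have h3 : ∀ {c : ℕ} (M : Matrix (Fin a) (Fin c) ℂ), A * (Q * (Aᴴ * M)) = P * M - M := fun M => by
    rw [← Matrix.mul_assoc Q, ← Matrix.mul_assoc, mul_defect_inv_mul hP hQ, Matrix.sub_mul,
      Matrix.one_mul]
  have h4 : Aᴴ * (A * Q) = Q - 1 := by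
    rw [← h1]; exact mul_defect_inv_mul hQ hP
  simp only [Matrix.mul_sub, Matrix.sub_mul, Matrix.mul_one, Matrix.one_mul, Matrix.mul_assoc, h1,
    h4]
  simp only [h2, h3]
  abel

/-- The automorphism of the matrix ball that moves `A` to the origin, normalized by factors `F` and
`K` of `1 - A Aᴴ` and `1 - Aᴴ A`. -/
noncomputable def mobius (A : Matrix (Fin a) (Fin b) ℂ) (F : Matrix (Fin a) (Fin a) ℂ)
    (K : Matrix (Fin b) (Fin b) ℂ) (Z : Matrix (Fin a) (Fin b) ℂ) : Matrix (Fin a) (Fin b) ℂ :=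
  F * ((1 - Z * Aᴴ)⁻¹ * (Z - A)) * K⁻¹

/-- The inverse of `mobius`. -/
noncomputable def mobiusInv (A : Matrix (Fin a) (Fin b) ℂ) (F : Matrix (Fin a) (Fin a) ℂ)
    (K : Matrix (Fin b) (Fin b) ℂ) (w : Matrix (Fin a) (Fin b) ℂ) : Matrix (Fin a) (Fin b) ℂ :=
  (F⁻¹ * w * K + A) * (1 + Aᴴ * (F⁻¹ * w * K))⁻¹

variable {F : Matrix (Fin a) (Fin a) ℂ} {K : Matrix (Fin b) (Fin b) ℂ}

/-- Both defects are Schur complements of the block matrix with identity diagonal blocks and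
off-diagonal blocks `Z`, `Zᴴ`, which gives semidefiniteness; `det (1 - Z Zᴴ) = det (1 - Zᴴ Z)` gives
definiteness. -/
theorem posDef_one_sub_conjTranspose_mul (hZ : Z ∈ matrixBall a b) : (1 - Zᴴ * Z).PosDef := by
  have h1 : (1 - Zᴴ * Z).IsHermitian := by simp [Matrix.IsHermitian]
  have h2 : (1 - Zᴴ * Z).PosSemidef := by
    have hI : ((1 : Matrix (Fin b) (Fin b) ℂ)).PosDef := .one
    have hI' : ((1 : Matrix (Fin a) (Fin a) ℂ)).PosDef := .one
    let _ : Invertible (1 : Matrix (Fin b) (Fin b) ℂ) := invertibleOne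
    let _ : Invertible (1 : Matrix (Fin a) (Fin a) ℂ) := invertibleOne
    have h3 := (Matrix.PosDef.fromBlocks₂₂ (1 : Matrix (Fin a) (Fin a) ℂ) Z hI).2 (by
      simpa [matrixBall, hermitianDefect] using Matrix.PosDef.posSemidef hZ)
    have h4 := (Matrix.PosDef.fromBlocks₁₁ Z (1 : Matrix (Fin b) (Fin b) ℂ) hI').1 h3
    simpa using h4
  refine h2.posDef_iff_det_ne_zero.2 ?_
  rw [← Matrix.det_one_sub_mul_comm]
  exact (Matrix.PosDef.det_pos hZ).ne'

theorem isUnit_det_of_conjTranspose_mul_self {n : ℕ} {M N : Matrix (Fin n) (Fin n) ℂ}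
    (h : Mᴴ * M = N) (hN : N.PosDef) : IsUnit M.det := by
  rw [isUnit_iff_ne_zero]
  intro h0
  have := hN.det_pos.ne'
  rw [← h, Matrix.det_mul, h0, mul_zero] at this
  exact this rfl

theorem mem_matrixBall_of_conjTranspose (hZ : (1 - Zᴴ * Z).PosDef) : Z ∈ matrixBall a b := by
  have h1 : Zᴴ ∈ matrixBall b a := by
    simpa [matrixBall, hermitianDefect] using hZ
  simpa [matrixBall, hermitianDefect] using posDef_one_sub_conjTranspose_mul h1

theorem inv_mul_conjTranspose_inv {n : ℕ} {M N : Matrix (Fin n) (Fin n) ℂ} (h : Mᴴ * M = N)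
    (hM : IsUnit M.det) : N * (M⁻¹ * M⁻¹ᴴ) = 1 := by
  rw [← h, Matrix.conjTranspose_nonsing_inv, ← Matrix.mul_inv_rev, Matrix.mul_nonsing_inv]
  rw [Matrix.det_mul]
  refine IsUnit.mul ?_ hM
  rw [Matrix.det_conjTranspose]
  exact hM.star

section

variable (hA : A ∈ matrixBall a b) (hF : Fᴴ * F = 1 - A * Aᴴ) (hK : Kᴴ * K = 1 - Aᴴ * A)

include hA hF hK

/-- By Hua's identity, `(1 - Z Aᴴ) P (1 - Z Aᴴ)ᴴ` is the sum of a positive definite and a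
semidefinite matrix. -/
theorem isUnit_det_one_sub_mul (hZ : Z ∈ matrixBall a b) : IsUnit (1 - Z * Aᴴ).det := by
  have hFu := isUnit_det_of_conjTranspose_mul_self hF hA
  have hKu := isUnit_det_of_conjTranspose_mul_self hK (posDef_one_sub_conjTranspose_mul hA)
  have h1 := defect_identity (Z := Z) (inv_mul_conjTranspose_inv hF hFu)
    (inv_mul_conjTranspose_inv hK hKu)
  have h2 : ((1 - Z * Aᴴ) * (F⁻¹ * F⁻¹ᴴ) * (1 - Z * Aᴴ)ᴴ).PosDef := by
    rw [sub_eq_iff_eq_add.1 h1]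
    refine Matrix.PosDef.add_posSemidef hZ ?_
    have := Matrix.posSemidef_self_mul_conjTranspose ((Z - A) * K⁻¹)
    rwa [Matrix.conjTranspose_mul, ← Matrix.mul_assoc, Matrix.mul_assoc (Z - A)] at this
  rw [isUnit_iff_ne_zero]
  intro h0
  have h3 := h2.det_pos.ne'
  rw [Matrix.det_mul, Matrix.det_mul, h0, zero_mul, zero_mul] at h3
  exact h3 rfl

theorem hermitianDefect_mobius (hZ : Z ∈ matrixBall a b) :
    hermitianDefect (mobius A F K Z) =
      (F * (1 - Z * Aᴴ)⁻¹) * hermitianDefect Z * (F * (1 - Z * Aᴴ)⁻¹)ᴴ := by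
  have hFu := isUnit_det_of_conjTranspose_mul_self hF hA
  have hKu := isUnit_det_of_conjTranspose_mul_self hK (posDef_one_sub_conjTranspose_mul hA)
  have hY := isUnit_det_one_sub_mul hA hF hK hZ
  have h1 := defect_identity (Z := Z) (inv_mul_conjTranspose_inv hF hFu)
    (inv_mul_conjTranspose_inv hK hKu)
  rw [hermitianDefect, hermitianDefect, ← h1]
  unfold mobius
  generalize 1 - Z * Aᴴ = Y at hY
  generalize Z - A = X
  have h2 : F * Y⁻¹ * (Y * (F⁻¹ * F⁻¹ᴴ) * Yᴴ) * (F * Y⁻¹)ᴴ = 1 := by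
    have e1 : F * Y⁻¹ * (Y * (F⁻¹ * F⁻¹ᴴ) * Yᴴ) * (F * Y⁻¹)ᴴ =
        F * (Y⁻¹ * Y) * F⁻¹ * (F * (Y⁻¹ * Y) * F⁻¹)ᴴ := by
      simp only [Matrix.conjTranspose_mul, Matrix.mul_assoc]
    rw [e1, Matrix.nonsing_inv_mul _ hY, Matrix.mul_one, Matrix.mul_nonsing_inv _ hFu]
    simp
  rw [Matrix.mul_sub, Matrix.sub_mul, h2]
  simp only [Matrix.conjTranspose_mul, Matrix.mul_assoc]

theorem mobius_mem (hZ : Z ∈ matrixBall a b) : mobius A F K Z ∈ matrixBall a b := by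
  have hFu := isUnit_det_of_conjTranspose_mul_self hF hA
  have hY := isUnit_det_one_sub_mul hA hF hK hZ
  change (hermitianDefect _).PosDef
  rw [hermitianDefect_mobius hA hF hK hZ]
  refine Matrix.PosDef.mul_mul_conjTranspose_same hZ ?_
  rw [Matrix.vecMul_injective_iff_isUnit, Matrix.isUnit_iff_isUnit_det, Matrix.det_mul]
  exact hFu.mul ((Matrix.isUnit_nonsing_inv_det_iff).2 hY)

/-- With `D = 1 + Aᴴ u`, the identity `Dᴴ D - (u + A)ᴴ (u + A) = Kᴴ (1 - wᴴ w) K` gives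
invertibility of `D` and, after conjugation by `D⁻¹`, membership in the ball. -/
theorem isUnit_det_one_add_mul {u w : Matrix (Fin a) (Fin b) ℂ} (hw : w ∈ matrixBall a b)
    (hu : F⁻¹ * w * K = u) :
    IsUnit (1 + Aᴴ * u).det ∧ (u + A) * (1 + Aᴴ * u)⁻¹ ∈ matrixBall a b := by
  have hFu := isUnit_det_of_conjTranspose_mul_self hF hA
  have hKu := isUnit_det_of_conjTranspose_mul_self hK (posDef_one_sub_conjTranspose_mul hA)
  have h1 : (1 + Aᴴ * u)ᴴ * (1 + Aᴴ * u) - (u + A)ᴴ * (u + A) = Kᴴ * (1 - wᴴ * w) * K := by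
    have h2 : uᴴ * (Fᴴ * F) * u = Kᴴ * (wᴴ * w) * K := by
      rw [← hu]
      have e1 : (F⁻¹ * w * K)ᴴ * (Fᴴ * F) * (F⁻¹ * w * K) =
          Kᴴ * ((F * F⁻¹ * w)ᴴ * (F * F⁻¹ * w)) * K := by
        simp only [Matrix.conjTranspose_mul, Matrix.mul_assoc]
      rw [e1, Matrix.mul_nonsing_inv _ hFu, Matrix.one_mul]
    rw [Matrix.mul_sub, Matrix.sub_mul, Matrix.mul_one, hK, ← h2, hF]
    simp only [Matrix.conjTranspose_add, Matrix.conjTranspose_mul, Matrix.conjTranspose_one,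
      Matrix.conjTranspose_conjTranspose, Matrix.mul_sub, Matrix.sub_mul, Matrix.mul_add,
      Matrix.add_mul, Matrix.mul_one, Matrix.one_mul, Matrix.mul_assoc]
    abel
  have h3 : (Kᴴ * (1 - wᴴ * w) * K).PosDef := by
    refine (posDef_one_sub_conjTranspose_mul hw).conjTranspose_mul_mul_same ?_
    rwa [Matrix.mulVec_injective_iff_isUnit, Matrix.isUnit_iff_isUnit_det]
  have hD : IsUnit (1 + Aᴴ * u).det := by
    refine isUnit_det_of_conjTranspose_mul_self rfl ?_
    rw [sub_eq_iff_eq_add.1 h1]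
    exact h3.add_posSemidef (Matrix.posSemidef_conjTranspose_mul_self _)
  refine ⟨hD, mem_matrixBall_of_conjTranspose ?_⟩
  have h4 : 1 - ((u + A) * (1 + Aᴴ * u)⁻¹)ᴴ * ((u + A) * (1 + Aᴴ * u)⁻¹) =
      (1 + Aᴴ * u)⁻¹ᴴ * (Kᴴ * (1 - wᴴ * w) * K) * (1 + Aᴴ * u)⁻¹ := by
    rw [← h1]
    generalize 1 + Aᴴ * u = D at hD
    have e1 : D⁻¹ᴴ * (Dᴴ * D) * D⁻¹ = (D * D⁻¹)ᴴ * (D * D⁻¹) := by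
      simp only [Matrix.conjTranspose_mul, Matrix.mul_assoc]
    rw [Matrix.mul_sub, Matrix.sub_mul, e1, Matrix.mul_nonsing_inv _ hD]
    simp only [Matrix.conjTranspose_mul, Matrix.mul_assoc, Matrix.conjTranspose_one, Matrix.mul_one]
  rw [h4]
  refine h3.conjTranspose_mul_mul_same ?_
  rw [Matrix.mulVec_injective_iff_isUnit, Matrix.isUnit_iff_isUnit_det]
  exact (Matrix.isUnit_nonsing_inv_det_iff).2 hD

theorem mobiusInv_mem {w : Matrix (Fin a) (Fin b) ℂ} (hw : w ∈ matrixBall a b) :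
    mobiusInv A F K w ∈ matrixBall a b :=
  (isUnit_det_one_add_mul hA hF hK hw rfl).2

/-- The equations `(1 - Z Aᴴ) u = Z - A` and `Z (1 + Aᴴ u) = u + A` are the same; one is solved for
`u`, the other for `Z`. -/
theorem mobiusInv_mobius (hZ : Z ∈ matrixBall a b) : mobiusInv A F K (mobius A F K Z) = Z := by
  have hFu := isUnit_det_of_conjTranspose_mul_self hF hA
  have hKu := isUnit_det_of_conjTranspose_mul_self hK (posDef_one_sub_conjTranspose_mul hA)
  have hY := isUnit_det_one_sub_mul hA hF hK hZ
  have hu : F⁻¹ * mobius A F K Z * K = (1 - Z * Aᴴ)⁻¹ * (Z - A) := by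
    have e1 : F⁻¹ * mobius A F K Z * K = F⁻¹ * F * ((1 - Z * Aᴴ)⁻¹ * (Z - A)) * (K⁻¹ * K) := by
      simp only [mobius, Matrix.mul_assoc]
    rw [e1, Matrix.nonsing_inv_mul _ hFu, Matrix.nonsing_inv_mul _ hKu, Matrix.one_mul,
      Matrix.mul_one]
  have hD := (isUnit_det_one_add_mul hA hF hK (mobius_mem hA hF hK hZ) rfl).1
  rw [mobiusInv]
  rw [hu] at hD ⊢
  have h1 : (1 - Z * Aᴴ) * ((1 - Z * Aᴴ)⁻¹ * (Z - A)) = Z - A := by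
    rw [← Matrix.mul_assoc, Matrix.mul_nonsing_inv _ hY, Matrix.one_mul]
  generalize (1 - Z * Aᴴ)⁻¹ * (Z - A) = u at h1 hD
  have h2 : u + A = Z * (1 + Aᴴ * u) := by
    rw [Matrix.sub_mul, Matrix.one_mul, sub_eq_iff_eq_add] at h1
    rw [Matrix.mul_add, Matrix.mul_one, ← Matrix.mul_assoc]
    nth_rewrite 1 [h1]
    abel
  rw [h2, Matrix.mul_assoc, Matrix.mul_nonsing_inv _ hD, Matrix.mul_one]

theorem mobius_mobiusInv {w : Matrix (Fin a) (Fin b) ℂ} (hw : w ∈ matrixBall a b) :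
    mobius A F K (mobiusInv A F K w) = w := by
  have hFu := isUnit_det_of_conjTranspose_mul_self hF hA
  have hKu := isUnit_det_of_conjTranspose_mul_self hK (posDef_one_sub_conjTranspose_mul hA)
  have hD := (isUnit_det_one_add_mul hA hF hK hw rfl).1
  have hY := isUnit_det_one_sub_mul hA hF hK (mobiusInv_mem hA hF hK hw)
  have h1 : mobiusInv A F K w * (1 + Aᴴ * (F⁻¹ * w * K)) = F⁻¹ * w * K + A := by
    rw [mobiusInv, Matrix.mul_assoc, Matrix.nonsing_inv_mul _ hD, Matrix.mul_one]
  rw [mobius]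
  generalize mobiusInv A F K w = Z at h1 hY
  have h2 : Z - A = (1 - Z * Aᴴ) * (F⁻¹ * w * K) := by
    rw [Matrix.mul_add, Matrix.mul_one, ← eq_sub_iff_add_eq] at h1
    nth_rewrite 1 [h1]
    rw [Matrix.sub_mul, Matrix.one_mul, Matrix.mul_assoc Z]
    abel
  rw [h2, ← Matrix.mul_assoc (1 - Z * Aᴴ)⁻¹, Matrix.nonsing_inv_mul _ hY, Matrix.one_mul]
  have e1 : F * (F⁻¹ * w * K) * K⁻¹ = F * F⁻¹ * w * (K * K⁻¹) := by
    simp only [Matrix.mul_assoc]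
  rw [e1, Matrix.mul_nonsing_inv _ hFu, Matrix.mul_nonsing_inv _ hKu, Matrix.one_mul, Matrix.mul_one]

theorem differentiableOn_mobius : DifferentiableOn ℂ (mobius A F K) (matrixBall a b) := by
  have h1 : DifferentiableOn ℂ (fun Z : Matrix (Fin a) (Fin b) ℂ => 1 - Z * Aᴴ) (matrixBall a b) :=
    (differentiableOn_id.matrix_mul (differentiableOn_const _)).const_sub _
  have h2 : DifferentiableOn ℂ (fun Z : Matrix (Fin a) (Fin b) ℂ => Z - A) (matrixBall a b) :=
    differentiableOn_id.sub_const _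
  exact ((differentiableOn_const F).matrix_mul ((h1.matrix_inv fun Z hZ =>
    isUnit_det_one_sub_mul hA hF hK hZ).matrix_mul h2)).matrix_mul (differentiableOn_const _)

theorem differentiableOn_mobiusInv : DifferentiableOn ℂ (mobiusInv A F K) (matrixBall a b) := by
  have h1 : DifferentiableOn ℂ (fun w : Matrix (Fin a) (Fin b) ℂ => F⁻¹ * w * K)
      (matrixBall a b) :=
    ((differentiableOn_const _).matrix_mul differentiableOn_id).matrix_mul (differentiableOn_const _)
  exact (h1.add_const _).matrix_mul ((((differentiableOn_const _).matrix_mul h1).const_add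
    _).matrix_inv fun w hw => (isUnit_det_one_add_mul hA hF hK hw rfl).1)

theorem holomorphicEquivOn_mobius :
    HolomorphicEquivOn (mobius A F K) (mobiusInv A F K) (matrixBall a b) (matrixBall a b) where
  differentiableOn := differentiableOn_mobius hA hF hK
  continuousOn := (differentiableOn_mobiusInv hA hF hK).continuousOn
  mapsTo _ hZ := mobius_mem hA hF hK hZ
  mapsTo_inv _ hw := mobiusInv_mem hA hF hK hw
  leftInvOn _ hZ := mobiusInv_mobius hA hF hK hZ
  rightInvOn _ hw := mobius_mobiusInv hA hF hK hw

/-- The generic norm is multiplied by `|det F / det (1 - Z Aᴴ)|²`, and the denominator has a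
holomorphic logarithm on the star-shaped ball. -/
theorem exists_log_det_mobius :
    ∃ h : Matrix (Fin a) (Fin b) ℂ → ℂ, DifferentiableOn ℂ h (matrixBall a b) ∧
      ∀ Z ∈ matrixBall a b, (hermitianDefect (mobius A F K Z)).det.re =
        (hermitianDefect Z).det.re * Real.exp (h Z).re := by
  have hFu := isUnit_det_of_conjTranspose_mul_self hF hA
  have hdet : DifferentiableOn ℂ (fun Z : Matrix (Fin a) (Fin b) ℂ => (1 - Z * Aᴴ).det)
      (matrixBall a b) :=
    ((differentiableOn_id.matrix_mul (differentiableOn_const _)).const_sub _).matrix_det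
  obtain ⟨q, hq, hqe⟩ := exists_holomorphic_log isOpen_matrixBall zero_mem_matrixBall
    (fun Z hZ t ht0 ht1 => smul_mem_matrixBall hZ ht0 ht1) hdet
    fun Z hZ => (isUnit_det_one_sub_mul hA hF hK hZ).ne_zero
  refine ⟨fun Z => 2 * (Complex.log F.det - q Z), (hq.const_sub _).const_mul _, fun Z hZ => ?_⟩
  have h1 : F.det * (1 - Z * Aᴴ).det⁻¹ = Complex.exp (Complex.log F.det - q Z) := by
    rw [Complex.exp_sub, Complex.exp_log hFu.ne_zero, hqe Z hZ, div_eq_mul_inv]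
  rw [hermitianDefect_mobius hA hF hK hZ, Matrix.det_mul, Matrix.det_mul,
    Matrix.det_conjTranspose, Matrix.det_mul, Matrix.det_nonsing_inv, Ring.inverse_eq_inv', h1,
    mul_right_comm, RCLike.star_def, Complex.mul_conj, Complex.re_ofReal_mul, mul_comm,
    Complex.normSq_eq_norm_sq, Complex.norm_exp, ← Real.exp_nat_mul]
  congr 2
  simp

end

theorem conjTranspose_transpose_comm (M : Matrix (Fin a) (Fin b) ℂ) : Mᵀᴴ = Mᴴᵀ := rfl

/-- Here `σ = ±1` treats symmetric and skew matrices together. The choice `K = Fᴴᵀ` makes the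
transposed map the right-handed form of the same Möbius map, and `defect_intertwining` converts it
back. -/
theorem transpose_mobius {σ : ℂ} (hσ : σ * σ = 1) (hσ' : star σ = σ)
    {A F Z : Matrix (Fin a) (Fin a) ℂ} (hAB : A ∈ matrixBall a a) (hA : Aᵀ = σ • A)
    (hF : Fᴴ * F = 1 - A * Aᴴ) (hZ : σ • Zᵀ ∈ matrixBall a a) :
    Fᴴᵀᴴ * Fᴴᵀ = 1 - Aᴴ * A ∧ (mobius A F Fᴴᵀ Z)ᵀ = σ • mobius A F Fᴴᵀ (σ • Zᵀ) := by
  have hA' : Aᴴᵀ = σ • Aᴴ := by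
    rw [← conjTranspose_transpose_comm, hA, Matrix.conjTranspose_smul, hσ']
  have hK : Fᴴᵀᴴ * Fᴴᵀ = 1 - Aᴴ * A := by
    rw [conjTranspose_transpose_comm, Matrix.conjTranspose_conjTranspose,
      ← Matrix.transpose_mul, hF, Matrix.transpose_sub, Matrix.transpose_mul, hA, hA',
      Matrix.smul_mul, Matrix.mul_smul, smul_smul, hσ, one_smul, Matrix.transpose_one]
  refine ⟨hK, ?_⟩
  have hFu := isUnit_det_of_conjTranspose_mul_self hF hAB
  have hKu := isUnit_det_of_conjTranspose_mul_self hK (posDef_one_sub_conjTranspose_mul hAB)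
  generalize hZ' : σ • Zᵀ = Z' at hZ
  have hZt : Zᵀ = σ • Z' := by rw [← hZ', smul_smul, hσ, one_smul]
  have hY := isUnit_det_one_sub_mul hAB hF hK hZ
  have hY2 : IsUnit (1 - Aᴴ * Z').det := by rwa [← Matrix.det_one_sub_mul_comm]
  have h1 := defect_intertwining (Z := Z') (inv_mul_conjTranspose_inv hF hFu)
    (inv_mul_conjTranspose_inv hK hKu)
  have h2 : (mobius A F Fᴴᵀ Z)ᵀ = σ • ((F⁻¹)ᴴ * ((Z' - A) * (1 - Aᴴ * Z')⁻¹) * Fᴴᵀᴴ) := by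
    have e1 : (1 - Z * Aᴴ)ᵀ = 1 - Aᴴ * Z' := by
      rw [Matrix.transpose_sub, Matrix.transpose_mul, hA', hZt, Matrix.smul_mul, Matrix.mul_smul,
        smul_smul, hσ, one_smul, Matrix.transpose_one]
    have e2 : (Z - A)ᵀ = σ • (Z' - A) := by
      rw [Matrix.transpose_sub, hA, hZt, smul_sub]
    rw [mobius, Matrix.transpose_mul, Matrix.transpose_mul, Matrix.transpose_mul,
      Matrix.transpose_nonsing_inv, Matrix.transpose_nonsing_inv, e1, e2,
      Matrix.transpose_transpose, ← Matrix.conjTranspose_nonsing_inv,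
      conjTranspose_transpose_comm, Matrix.conjTranspose_conjTranspose]
    simp only [Matrix.smul_mul, Matrix.mul_smul, Matrix.mul_assoc]
  rw [h2, mobius]
  congr 1
  generalize Fᴴᵀ = K at *
  generalize 1 - Aᴴ * Z' = Y₂ at *
  generalize 1 - Z' * Aᴴ = Y at *
  generalize Z' - A = X at *
  have hKu' : IsUnit Kᴴ.det := by rw [Matrix.det_conjTranspose]; exact hKu.star
  have e1 : F * Y⁻¹ * (Y * (F⁻¹ * F⁻¹ᴴ) * X) * (Y₂⁻¹ * Kᴴ) =
      F * (Y⁻¹ * Y) * F⁻¹ * (F⁻¹ᴴ * (X * Y₂⁻¹) * Kᴴ) := by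
    simp only [Matrix.mul_assoc]
  have e2 : F * Y⁻¹ * (X * (K⁻¹ * K⁻¹ᴴ) * Y₂) * (Y₂⁻¹ * Kᴴ) =
      F * (Y⁻¹ * X) * K⁻¹ * (K⁻¹ᴴ * (Y₂ * Y₂⁻¹) * Kᴴ) := by
    simp only [Matrix.mul_assoc]
  rw [← h1] at e2
  rw [e2, Matrix.nonsing_inv_mul _ hY, Matrix.mul_one, Matrix.mul_nonsing_inv _ hFu, Matrix.one_mul,
    Matrix.mul_nonsing_inv _ hY2, Matrix.mul_one, Matrix.conjTranspose_nonsing_inv,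
    Matrix.nonsing_inv_mul _ hKu', Matrix.mul_one] at e1
  exact e1.symm

theorem smul_transpose_mem_matrixBall {σ : ℂ} (hσ : σ * σ = 1) (hσ' : star σ = σ)
    {Z : Matrix (Fin a) (Fin b) ℂ} (hZ : Z ∈ matrixBall a b) : σ • Zᵀ ∈ matrixBall b a := by
  have h1 : hermitianDefect (σ • Zᵀ) = (1 - Zᴴ * Z)ᵀ := by
    rw [hermitianDefect, Matrix.conjTranspose_smul, hσ', Matrix.smul_mul, Matrix.mul_smul,
      smul_smul, hσ, one_smul, Matrix.transpose_sub, Matrix.transpose_mul, Matrix.transpose_one,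
      conjTranspose_transpose_comm]
  change (hermitianDefect (σ • Zᵀ)).PosDef
  rw [h1]
  exact (posDef_one_sub_conjTranspose_mul hZ).transpose

open scoped MatrixOrder in
theorem exists_conjTranspose_mul_self {n : ℕ} {P : Matrix (Fin n) (Fin n) ℂ} (hP : P.PosDef) :
    ∃ F : Matrix (Fin n) (Fin n) ℂ, Fᴴ * F = P := by
  obtain ⟨B, hB⟩ := CStarAlgebra.nonneg_iff_eq_star_mul_self.mp hP.posSemidef.nonneg
  exact ⟨B, hB.symm⟩

end Mobius

/-! ### The first three series as homogeneous bases -/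

section MatrixBase

open ClassicalSeries

variable {a b : ℕ}

/-- A continuous linear projection onto `S` makes the restricted maps total with values in `S`; on
`B` it changes nothing. -/
theorem HolomorphicEquivOn.exists_restrict {V : Type*} [NormedAddCommGroup V] [NormedSpace ℂ V]
    [FiniteDimensional ℂ V] {φ ψ : V → V} {B : Set V} (h : HolomorphicEquivOn φ ψ B B)
    (S : Submodule ℂ V) (hφ : ∀ Z ∈ B, Z ∈ S → φ Z ∈ S) (hψ : ∀ Z ∈ B, Z ∈ S → ψ Z ∈ S) :
    ∃ φ' ψ' : S → S, HolomorphicEquivOn φ' ψ' (Subtype.val ⁻¹' B) (Subtype.val ⁻¹' B) ∧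
      ∀ Z : S, Z.1 ∈ B → (φ' Z).1 = φ Z.1 := by
  obtain ⟨π, hπ⟩ := Submodule.ClosedComplemented.of_finiteDimensional S
  have h1 : ∀ Z : S, Z.1 ∈ B → (π (φ Z.1)).1 = φ Z.1 := fun Z hZ =>
    congrArg Subtype.val (hπ ⟨_, hφ Z.1 hZ Z.2⟩)
  have h2 : ∀ Z : S, Z.1 ∈ B → (π (ψ Z.1)).1 = ψ Z.1 := fun Z hZ =>
    congrArg Subtype.val (hπ ⟨_, hψ Z.1 hZ Z.2⟩)
  refine ⟨fun Z => π (φ Z.1), fun Z => π (ψ Z.1), ⟨?_, ?_, ?_, ?_, ?_, ?_⟩, h1⟩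
  · exact π.differentiable.comp_differentiableOn
      (h.differentiableOn.comp S.subtypeL.differentiable.differentiableOn fun Z hZ => hZ)
  · exact π.continuous.comp_continuousOn
      (h.continuousOn.comp continuous_subtype_val.continuousOn fun Z hZ => hZ)
  · intro Z hZ
    rw [mem_preimage, h1 Z hZ]
    exact h.mapsTo hZ
  · intro Z hZ
    rw [mem_preimage, h2 Z hZ]
    exact h.mapsTo_inv hZ
  · intro Z hZ
    refine Subtype.ext ?_
    have h3 := h.mapsTo hZ
    rw [← h1 Z hZ] at h3
    rw [h2 _ h3, h1 Z hZ, h.leftInvOn hZ]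
  · intro Z hZ
    refine Subtype.ext ?_
    have h3 := h.mapsTo_inv hZ
    rw [← h2 Z hZ] at h3
    rw [h1 _ h3, h2 Z hZ, h.rightInvOn hZ]

/-- The matrix with the Frobenius norm as a vector in a Euclidean space. -/
noncomputable def frobeniusIsometry (a b : ℕ) :
    Matrix (Fin a) (Fin b) ℂ →ₗᵢ[ℂ] EuclideanSpace ℂ (Fin a × Fin b) where
  toFun Z := WithLp.toLp 2 fun p => Z p.1 p.2
  map_add' _ _ := rfl
  map_smul' _ _ := rfl
  norm_map' Z := by
    rw [← sq_eq_sq₀ (norm_nonneg _) (norm_nonneg _), norm_sq_eq_trace, EuclideanSpace.norm_sq_eq]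
    simp only [Matrix.trace, Matrix.mul_apply, Matrix.diag_apply, Matrix.conjTranspose_apply,
      Complex.re_sum, Fintype.sum_prod_type]
    refine Finset.sum_congr rfl fun i _ => Finset.sum_congr rfl fun j _ => ?_
    rw [RCLike.star_def, Complex.mul_conj, Complex.ofReal_re, Complex.normSq_eq_norm_sq]
    rfl

/-- The image of a space of matrices in the Euclidean space. -/
noncomputable abbrev euclideanImage (S : Submodule ℂ (Matrix (Fin a) (Fin b) ℂ)) :
    Submodule ℂ (EuclideanSpace ℂ (Fin a × Fin b)) :=
  LinearMap.range ((frobeniusIsometry a b).comp S.subtypeₗᵢ).toLinearMap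

/-- The Frobenius isometry of a space of matrices onto its image. -/
noncomputable def matrixEuclideanEquiv (S : Submodule ℂ (Matrix (Fin a) (Fin b) ℂ)) :
    S ≃ₗᵢ[ℂ] euclideanImage S :=
  ((frobeniusIsometry a b).comp S.subtypeₗᵢ).equivRange

theorem norm_matrixEuclideanEquiv (S : Submodule ℂ (Matrix (Fin a) (Fin b) ℂ)) (Z : S) :
    ‖(matrixEuclideanEquiv S).toContinuousLinearEquiv Z‖ = ‖Z.1‖ :=
  (matrixEuclideanEquiv S).norm_map Z

theorem homogeneousBase_matrixBall (S : Submodule ℂ (Matrix (Fin a) (Fin b) ℂ))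
    (hS : ∀ A ∈ matrixBall a b, A ∈ S → ∃ F K, Fᴴ * F = 1 - A * Aᴴ ∧ Kᴴ * K = 1 - Aᴴ * A ∧
      (∀ Z ∈ matrixBall a b, Z ∈ S → mobius A F K Z ∈ S) ∧
      ∀ w ∈ matrixBall a b, w ∈ S → mobiusInv A F K w ∈ S) :
    HomogeneousBase (X := euclideanImage S) {Z : S | (hermitianDefect Z.1).PosDef}
      (fun Z : S => (hermitianDefect Z.1).det.re)
      (matrixEuclideanEquiv S).toContinuousLinearEquiv where
  isOpen := isOpen_matrixBall.preimage continuous_subtype_val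
  isBounded := by
    obtain ⟨C, hC⟩ := isBounded_iff_forall_norm_le.1 (isBounded_matrixBall (a := a) (b := b))
    exact isBounded_iff_forall_norm_le.2 ⟨C, fun Z hZ => hC Z.1 hZ⟩
  zero_mem := zero_mem_matrixBall
  smul_mem Z hZ t ht0 ht1 := smul_mem_matrixBall hZ ht0 ht1
  continuous := by
    have := continuous_hermitianDefect (a := a) (b := b)
    fun_prop
  pos Z hZ := det_hermitianDefect_pos hZ
  mem_of_closure Z hZ hN := by
    refine mem_matrixBall_of_closure ?_ hN
    exact closure_mono (image_subset_iff.2 fun Z hZ => hZ)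
      (image_closure_subset_closure_image continuous_subtype_val ⟨Z, hZ, rfl⟩)
  lower Z hZ := by
    rw [norm_matrixEuclideanEquiv]; exact (det_hermitianDefect_bounds hZ).1
  upper Z hZ := by
    rw [norm_matrixEuclideanEquiv]; exact (det_hermitianDefect_bounds hZ).2
  transitive A hA := by
    obtain ⟨F, K, hF, hK, hφ, hψ⟩ := hS A.1 hA A.2
    obtain ⟨φ, ψ, h, hφe⟩ := (holomorphicEquivOn_mobius hA hF hK).exists_restrict S hφ hψ
    obtain ⟨q, hq, hqN⟩ := exists_log_det_mobius hA hF hK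
    refine ⟨φ, ψ, fun Z => q Z.1, h, ?_, ?_, fun Z hZ => ?_⟩
    · refine Subtype.ext ?_
      rw [hφe A hA]
      simp [mobius]
    · exact hq.comp S.subtypeL.differentiable.differentiableOn fun Z hZ => hZ
    · simp only [hφe Z hZ]
      exact hqN Z.1 hZ

theorem homogeneousBase_all :
    HomogeneousBase (X := euclideanImage ⊤) {Z : (⊤ : Submodule ℂ (Matrix (Fin a) (Fin b) ℂ)) |
      (hermitianDefect Z.1).PosDef} (fun Z => (hermitianDefect Z.1).det.re) 
      (matrixEuclideanEquiv ⊤).toContinuousLinearEquiv := by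
  refine homogeneousBase_matrixBall ⊤ fun A hA _ => ?_
  obtain ⟨F, hF⟩ := exists_conjTranspose_mul_self hA
  obtain ⟨K, hK⟩ := exists_conjTranspose_mul_self (posDef_one_sub_conjTranspose_mul hA)
  exact ⟨F, K, hF, hK, fun _ _ _ => trivial, fun _ _ _ => trivial⟩

theorem homogeneousBase_transpose (S : Submodule ℂ (Matrix (Fin a) (Fin a) ℂ)) {σ : ℂ}
    (hσ : σ * σ = 1) (hσ' : star σ = σ) (hS : ∀ Z, Z ∈ S ↔ Zᵀ = σ • Z) :
    HomogeneousBase (X := euclideanImage S) {Z : S | (hermitianDefect Z.1).PosDef}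
      (fun Z => (hermitianDefect Z.1).det.re)
      (matrixEuclideanEquiv S).toContinuousLinearEquiv := by
  refine homogeneousBase_matrixBall S fun A hA hAS => ?_
  obtain ⟨F, hF⟩ := exists_conjTranspose_mul_self hA
  have hK := (transpose_mobius hσ hσ' hA ((hS A).1 hAS) hF
    (smul_transpose_mem_matrixBall hσ hσ' hA)).1
  have hmap : ∀ Z ∈ matrixBall a a, (mobius A F Fᴴᵀ Z)ᵀ = σ • mobius A F Fᴴᵀ (σ • Zᵀ) :=
    fun Z hZ => (transpose_mobius hσ hσ' hA ((hS A).1 hAS) hF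
      (smul_transpose_mem_matrixBall hσ hσ' hZ)).2
  refine ⟨F, Fᴴᵀ, hF, hK, fun Z hZ hZS => ?_, fun w hw hwS => ?_⟩
  · rw [hS, hmap Z hZ, (hS Z).1 hZS, smul_smul, hσ, one_smul]
  -- For the inverse, the transposition rule shows that the preimage of `w` and its `σ`-transpose
  -- have the same image, so they coincide.
  · have hZ := mobiusInv_mem hA hF hK hw
    have h1 := hmap _ hZ
    rw [mobius_mobiusInv hA hF hK hw, (hS w).1 hwS] at h1
    have h2 := congrArg (σ • ·) h1
    simp only [smul_smul, hσ, one_smul] at h2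
    have h3 := congrArg (mobiusInv A F Fᴴᵀ) h2
    rw [mobiusInv_mobius hA hF hK (smul_transpose_mem_matrixBall hσ hσ' hZ)] at h3
    rw [hS]
    conv_rhs => rw [h3]
    rw [smul_smul, hσ, one_smul]

end MatrixBase

/-! ### The Lie ball and its boosts -/

section LieBall

open ClassicalSeries

variable {n : ℕ}

/-- The Lie ball in `ℂⁿ`. -/
def lieBall (n : ℕ) : Set (Matrix (Fin 1) (Fin n) ℂ) :=
  {Z | 0 < rowNorm Z ∧ 0 < 1 - ‖rowSquare Z‖}

theorem norm_rowSquare_le (Z : Matrix (Fin 1) (Fin n) ℂ) :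
    ‖rowSquare Z‖ ≤ ∑ j, ‖Z 0 j‖ ^ 2 := by
  refine (norm_sum_le _ _).trans_eq ?_
  simp

theorem norm_sq_row (Z : Matrix (Fin 1) (Fin n) ℂ) : ‖Z‖ ^ 2 = ∑ j, ‖Z 0 j‖ ^ 2 := by
  rw [norm_sq_eq_trace]
  simp only [Matrix.trace, Matrix.mul_apply, Matrix.diag_apply, Matrix.conjTranspose_apply,
    Complex.re_sum, Finset.univ_unique, Finset.sum_singleton]
  refine Finset.sum_congr rfl fun j _ => ?_
  rw [RCLike.star_def, Complex.mul_conj, Complex.ofReal_re, Complex.normSq_eq_norm_sq]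
  rfl

theorem rowSquare_smul (u : ℂ) (Z : Matrix (Fin 1) (Fin n) ℂ) :
    rowSquare (u • Z) = u ^ 2 * rowSquare Z := by
  simp [rowSquare, mul_pow, Finset.mul_sum]

theorem sum_norm_smul (u : ℂ) (Z : Matrix (Fin 1) (Fin n) ℂ) :
    ∑ j, ‖(u • Z) 0 j‖ ^ 2 = ‖u‖ ^ 2 * ∑ j, ‖Z 0 j‖ ^ 2 := by
  simp [mul_pow, Finset.mul_sum]

theorem differentiable_rowSquare :
    Differentiable ℂ (rowSquare : Matrix (Fin 1) (Fin n) ℂ → ℂ) := by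
  unfold rowSquare
  exact .fun_sum fun j _ => (differentiable_matrix_entry 0 j).pow 2

theorem continuous_rowNorm : Continuous (rowNorm : Matrix (Fin 1) (Fin n) ℂ → ℝ) := by
  unfold rowNorm
  have := differentiable_rowSquare (n := n).continuous
  fun_prop

theorem continuous_rowSquare : Continuous (rowSquare : Matrix (Fin 1) (Fin n) ℂ → ℂ) :=
  differentiable_rowSquare.continuous

theorem isOpen_lieBall : IsOpen (lieBall n) :=
  (isOpen_lt continuous_const continuous_rowNorm).inter
    (isOpen_lt continuous_const (continuous_const.sub continuous_rowSquare.norm))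

theorem sum_lt_one {Z : Matrix (Fin 1) (Fin n) ℂ} (hZ : Z ∈ lieBall n) :
    ∑ j, ‖Z 0 j‖ ^ 2 < 1 := by
  obtain ⟨h1, h2⟩ := hZ
  rw [rowNorm] at h1
  nlinarith [norm_nonneg (rowSquare Z)]

/-- The inner product with a real vector. -/
noncomputable def realPairing (e : Fin n → ℝ) (Z : Matrix (Fin 1) (Fin n) ℂ) : ℂ :=
  ∑ j, e j * Z 0 j

/-- The matrix of a real vector. -/
def realRow (e : Fin n → ℝ) : Matrix (Fin 1) (Fin n) ℂ := Matrix.of fun _ j => (e j : ℂ)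

/-- The automorphy factor of `lieBoost`. -/
noncomputable def boostFactor (e : Fin n → ℝ) (c d : ℝ) (Z : Matrix (Fin 1) (Fin n) ℂ) : ℂ :=
  ((1 - rowSquare Z) + (c * (1 + rowSquare Z) - 2 * d * realPairing e Z)) / 2

/-- The automorphism of the Lie ball induced by a hyperbolic rotation with cosine `c` and sine `d`
in the direction of the real unit vector `e`. -/
noncomputable def lieBoost (e : Fin n → ℝ) (c d : ℝ) (Z : Matrix (Fin 1) (Fin n) ℂ) :
    Matrix (Fin 1) (Fin n) ℂ :=
  (boostFactor e c d Z)⁻¹ •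
    (Z + ((c - 1) * realPairing e Z - d * (1 + rowSquare Z) / 2) • realRow e)

variable {e : Fin n → ℝ} {c d : ℝ} {Z : Matrix (Fin 1) (Fin n) ℂ}

theorem realPairing_add_smul (he : ∑ j, e j ^ 2 = 1) (κ : ℂ) :
    realPairing e (Z + κ • realRow e) = realPairing e Z + κ := by
  have h1 : (∑ j, (e j : ℂ) ^ 2) = 1 := by exact_mod_cast congrArg ((↑) : ℝ → ℂ) he
  simp only [realPairing, realRow, Matrix.add_apply, Matrix.smul_apply, Matrix.of_apply, smul_eq_mul,
    mul_add, Finset.sum_add_distrib]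
  congr 1
  trans κ * ∑ j, (e j : ℂ) ^ 2
  · rw [Finset.mul_sum]
    exact Finset.sum_congr rfl fun j _ => by ring
  · rw [h1, mul_one]

theorem rowSquare_add_smul (he : ∑ j, e j ^ 2 = 1) (κ : ℂ) :
    rowSquare (Z + κ • realRow e) = rowSquare Z + 2 * κ * realPairing e Z + κ ^ 2 := by
  have h1 : (∑ j, (e j : ℂ) ^ 2) = 1 := by exact_mod_cast congrArg ((↑) : ℝ → ℂ) he
  simp only [rowSquare, realPairing, realRow, Matrix.add_apply, Matrix.smul_apply, Matrix.of_apply,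
    smul_eq_mul]
  rw [← mul_one (κ ^ 2), ← h1, Finset.mul_sum, Finset.mul_sum, ← Finset.sum_add_distrib,
    ← Finset.sum_add_distrib]
  exact Finset.sum_congr rfl fun j _ => by ring

theorem sum_norm_add_smul (he : ∑ j, e j ^ 2 = 1) (κ : ℂ) :
    ∑ j, ‖(Z + κ • realRow e) 0 j‖ ^ 2 =
      ∑ j, ‖Z 0 j‖ ^ 2 - ‖realPairing e Z‖ ^ 2 + ‖realPairing e Z + κ‖ ^ 2 := by
  have h2 : ‖realPairing e Z + κ‖ ^ 2 - ‖realPairing e Z‖ ^ 2 =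
      2 * (κ.re * (realPairing e Z).re + κ.im * (realPairing e Z).im) + ‖κ‖ ^ 2 := by
    simp only [← Complex.normSq_eq_norm_sq, Complex.normSq_apply, Complex.add_re, Complex.add_im]
    ring
  have h3 : (realPairing e Z).re = ∑ j, e j * (Z 0 j).re := by simp [realPairing]
  have h4 : (realPairing e Z).im = ∑ j, e j * (Z 0 j).im := by simp [realPairing]
  have h5 : ∑ j, ‖(Z + κ • realRow e) 0 j‖ ^ 2 =
      ∑ j, (‖Z 0 j‖ ^ 2 + 2 * (κ.re * (e j * (Z 0 j).re) + κ.im * (e j * (Z 0 j).im)) +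
        ‖κ‖ ^ 2 * e j ^ 2) := by
    refine Finset.sum_congr rfl fun j _ => ?_
    simp only [realRow, Matrix.add_apply, Matrix.smul_apply, Matrix.of_apply, smul_eq_mul,
      ← Complex.normSq_eq_norm_sq, Complex.normSq_apply, Complex.add_re, Complex.add_im,
      Complex.mul_re, Complex.mul_im, Complex.ofReal_re, Complex.ofReal_im]
    ring
  rw [h5, Finset.sum_add_distrib, Finset.sum_add_distrib, ← Finset.mul_sum, ← Finset.mul_sum, he,
    Finset.sum_add_distrib, ← Finset.mul_sum, ← Finset.mul_sum, ← h3, ← h4]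
  linarith

theorem realPairing_smul (u : ℂ) : realPairing e (u • Z) = u * realPairing e Z := by
  simp only [realPairing, Matrix.smul_apply, smul_eq_mul, Finset.mul_sum]
  exact Finset.sum_congr rfl fun j _ => by ring

/-- Cauchy–Schwarz for the real numbers `Re (Z_j B̄)`, combined with `2 (Re x)² = |x|² + Re x²`. -/
theorem sq_re_pairing_le (he : ∑ j, e j ^ 2 = 1) (B : ℂ) :
    2 * ((realPairing e Z * star B).re) ^ 2 ≤
      ‖B‖ ^ 2 * ∑ j, ‖Z 0 j‖ ^ 2 + (star B ^ 2 * rowSquare Z).re := by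
  have h1 : (realPairing e Z * star B).re = ∑ j, e j * (Z 0 j * star B).re := by
    simp only [realPairing, Finset.sum_mul, Complex.re_sum]
    refine Finset.sum_congr rfl fun j _ => ?_
    rw [mul_assoc, Complex.re_ofReal_mul]
  have h2 := Finset.sum_mul_sq_le_sq_mul_sq Finset.univ e fun j => (Z 0 j * star B).re
  rw [he, one_mul, ← h1] at h2
  have h3 : ‖B‖ ^ 2 * ∑ j, ‖Z 0 j‖ ^ 2 + (star B ^ 2 * rowSquare Z).re =
      2 * ∑ j, (Z 0 j * star B).re ^ 2 := by
    rw [rowSquare, Finset.mul_sum, Finset.mul_sum, Finset.mul_sum, Complex.re_sum,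
      ← Finset.sum_add_distrib]
    refine Finset.sum_congr rfl fun j _ => ?_
    rw [pow_two (star B), pow_two (Z 0 j)]
    simp only [← Complex.normSq_eq_norm_sq, Complex.normSq_apply, RCLike.star_def, Complex.mul_re,
      Complex.mul_im, Complex.conj_re, Complex.conj_im]
    ring
  rw [h3]
  linarith

/-- The real part equals `c(1 - |s|²) - 2dq`. Cauchy–Schwarz and `N > 0` give `|2q| ≤ 1 - |s|²`,
while `|d| < c`. By `norm_add_sq_sub`, its positivity says that the new `Z Zᵗ` has modulus below
`1`. -/
theorem re_boost_pos (he : ∑ j, e j ^ 2 = 1) (hc : 0 < c) (hcd : c ^ 2 - d ^ 2 = 1)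
    (hZ : Z ∈ lieBall n) :
    0 < ((c * (1 + rowSquare Z) - 2 * d * realPairing e Z) * star (1 - rowSquare Z)).re := by
  obtain ⟨hN, hs⟩ := hZ
  have h1 := sq_re_pairing_le (Z := Z) he (1 - rowSquare Z)
  set s := rowSquare Z with hs_def
  set q := (realPairing e Z * star (1 - s)).re with hq
  have hS : ‖s‖ ^ 2 < 1 := by nlinarith [norm_nonneg s]
  have h2 : 2 * (‖1 - s‖ ^ 2 * ∑ j, ‖Z 0 j‖ ^ 2 + (star (1 - s) ^ 2 * s).re) =
      (1 - ‖s‖ ^ 2) ^ 2 - rowNorm Z * ‖1 - s‖ ^ 2 := by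
    have h3 : 2 * (∑ j, ‖Z 0 j‖ ^ 2) = 1 + ‖s‖ ^ 2 - rowNorm Z := by rw [rowNorm]; ring
    have h4 : ‖1 - s‖ ^ 2 * (1 + ‖s‖ ^ 2) + 2 * (star (1 - s) ^ 2 * s).re = (1 - ‖s‖ ^ 2) ^ 2 := by
      rw [pow_two (star (1 - s))]
      simp only [← Complex.normSq_eq_norm_sq, Complex.normSq_apply, RCLike.star_def, Complex.mul_re,
        Complex.mul_im, Complex.conj_re, Complex.conj_im, Complex.sub_re, Complex.sub_im,
        Complex.one_re, Complex.one_im]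
      ring
    linear_combination ‖1 - s‖ ^ 2 * h3 + h4
  have h3 : (2 * q) ^ 2 ≤ (1 - ‖s‖ ^ 2) ^ 2 := by
    have : 0 ≤ rowNorm Z * ‖1 - s‖ ^ 2 := by positivity
    nlinarith
  have h4 : ((c * (1 + s) - 2 * d * realPairing e Z) * star (1 - s)).re =
      c * (1 - ‖s‖ ^ 2) - d * (2 * q) := by
    have e1 : (c * (1 + s) - 2 * d * realPairing e Z) * star (1 - s) =
        (c : ℂ) * ((1 + s) * star (1 - s)) - ((2 * d : ℝ) : ℂ) * (realPairing e Z * star (1 - s)) := by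
      push_cast; ring
    have e2 : ((1 + s) * star (1 - s)).re = 1 - ‖s‖ ^ 2 := by
      simp only [← Complex.normSq_eq_norm_sq, Complex.normSq_apply, RCLike.star_def, Complex.mul_re,
        Complex.conj_re, Complex.conj_im, Complex.sub_re, Complex.sub_im, Complex.add_re,
        Complex.add_im, Complex.one_re, Complex.one_im]
      ring
    rw [e1, Complex.sub_re, Complex.re_ofReal_mul, Complex.re_ofReal_mul, e2]
    ring
  rw [h4]
  have h5 : |2 * q| ≤ 1 - ‖s‖ ^ 2 := by
    rw [← abs_of_pos (by linarith : 0 < 1 - ‖s‖ ^ 2)]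
    exact sq_le_sq.1 h3
  have h6 : |d| < c := by
    rw [← abs_of_pos hc]
    exact sq_lt_sq.1 (by linarith)
  have h7 : d * (2 * q) ≤ |d| * (1 - ‖s‖ ^ 2) := by
    refine (le_abs_self _).trans ?_
    rw [abs_mul]
    gcongr
  nlinarith

theorem norm_add_sq_sub (A B : ℂ) :
    ‖(B + A) / 2‖ ^ 2 - ‖(A - B) / 2‖ ^ 2 = (A * star B).re := by
  simp only [norm_div, div_pow, ← Complex.normSq_eq_norm_sq, Complex.normSq_apply, RCLike.star_def,
    Complex.mul_re, Complex.conj_re, Complex.conj_im, Complex.sub_re, Complex.sub_im, Complex.add_re,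
    Complex.add_im, Complex.re_ofNat, Complex.im_ofNat]
  ring

theorem boostFactor_ne_zero (he : ∑ j, e j ^ 2 = 1) (hc : 0 < c) (hcd : c ^ 2 - d ^ 2 = 1)
    (hZ : Z ∈ lieBall n) : boostFactor e c d Z ≠ 0 := by
  have h1 := re_boost_pos he hc hcd hZ
  rw [← norm_add_sq_sub] at h1
  intro h0
  rw [boostFactor] at h0
  rw [h0, norm_zero] at h1
  nlinarith [sq_nonneg ‖(c * (1 + rowSquare Z) - 2 * d * realPairing e Z - (1 - rowSquare Z)) / 2‖]

/-- On the lift, `s = (y₀ - y₁) / (y₀ + y₁)`; the boost changes `y₀` only, and `boostFactor` is the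
new `y₀ + y₁`. -/
theorem rowSquare_lieBoost (he : ∑ j, e j ^ 2 = 1) (hcd : c ^ 2 - d ^ 2 = 1)
    (h0 : boostFactor e c d Z ≠ 0) :
    rowSquare (lieBoost e c d Z) =
      (c * (1 + rowSquare Z) - 2 * d * realPairing e Z - (1 - rowSquare Z)) / 2 /
        boostFactor e c d Z := by
  have hcd' : (c : ℂ) ^ 2 - d ^ 2 = 1 := by exact_mod_cast congrArg ((↑) : ℝ → ℂ) hcd
  rw [lieBoost, rowSquare_smul, rowSquare_add_smul he, eq_div_iff h0, inv_pow]
  have h1 : ∀ x y : ℂ, x = y * boostFactor e c d Z →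
      (boostFactor e c d Z ^ 2)⁻¹ * x * boostFactor e c d Z = y := by
    intro x y h; rw [h]; field_simp
  refine h1 _ _ ?_
  rw [boostFactor]
  linear_combination (realPairing e Z ^ 2 - (1 + rowSquare Z) ^ 2 / 4) * hcd'

/-- The hyperbolic rotation preserves the Hermitian form on the lift; normalizing the lift divides
it by `|boostFactor|²`. -/
theorem rowNorm_lieBoost (he : ∑ j, e j ^ 2 = 1) (hcd : c ^ 2 - d ^ 2 = 1)
    (h0 : boostFactor e c d Z ≠ 0) :
    rowNorm (lieBoost e c d Z) * ‖boostFactor e c d Z‖ ^ 2 = rowNorm Z := by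
  rw [rowNorm, rowSquare_lieBoost he hcd h0, lieBoost, sum_norm_smul, sum_norm_add_smul he, norm_div,
    div_pow, norm_inv, inv_pow, rowNorm]
  have h1 : ‖boostFactor e c d Z‖ ≠ 0 := norm_ne_zero_iff.2 h0
  field_simp
  generalize ∑ j, ‖Z 0 j‖ ^ 2 = x
  rw [boostFactor]
  generalize realPairing e Z = l
  generalize rowSquare Z = s
  simp only [norm_div, div_pow, ← Complex.normSq_eq_norm_sq, Complex.normSq_apply, Complex.mul_re,
    Complex.mul_im, Complex.sub_re, Complex.sub_im, Complex.add_re, Complex.add_im, Complex.re_ofNat,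
    Complex.im_ofNat, Complex.ofReal_re, Complex.ofReal_im, Complex.one_re, Complex.one_im]
  linear_combination (((1 + s.re) ^ 2 + s.im ^ 2) / 2 - 2 * (l.re ^ 2 + l.im ^ 2)) * hcd

theorem lieBoost_mem (he : ∑ j, e j ^ 2 = 1) (hc : 0 < c) (hcd : c ^ 2 - d ^ 2 = 1)
    (hZ : Z ∈ lieBall n) : lieBoost e c d Z ∈ lieBall n := by
  have h0 := boostFactor_ne_zero he hc hcd hZ
  have h1 : 0 < ‖boostFactor e c d Z‖ := norm_pos_iff.2 h0
  have h2 := rowNorm_lieBoost he hcd h0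
  refine ⟨?_, ?_⟩
  · have h3 := hZ.1
    rw [← h2] at h3
    exact pos_of_mul_pos_left h3 (by positivity)
  · have h3 := re_boost_pos he hc hcd hZ
    rw [← norm_add_sq_sub] at h3
    rw [rowSquare_lieBoost he hcd h0, norm_div, sub_pos, div_lt_one h1]
    refine lt_of_pow_lt_pow_left₀ 2 h1.le ?_
    rw [boostFactor]
    linarith

theorem lieBoost_neg_lieBoost (he : ∑ j, e j ^ 2 = 1) (hcd : c ^ 2 - d ^ 2 = 1)
    (h0 : boostFactor e c d Z ≠ 0) : lieBoost e c (-d) (lieBoost e c d Z) = Z := by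
  have hcd' : (c : ℂ) ^ 2 - d ^ 2 = 1 := by exact_mod_cast congrArg ((↑) : ℝ → ℂ) hcd
  have hl : realPairing e (lieBoost e c d Z) =
      (c * realPairing e Z - d * (1 + rowSquare Z) / 2) / boostFactor e c d Z := by
    rw [lieBoost, realPairing_smul, realPairing_add_smul he, div_eq_inv_mul]
    ring
  have hs := rowSquare_lieBoost he hcd h0
  -- The cocycle relation for two inverse hyperbolic rotations.
  have h1 : boostFactor e c (-d) (lieBoost e c d Z) = (boostFactor e c d Z)⁻¹ := by
    rw [boostFactor, hl, hs]
    refine eq_inv_of_mul_eq_one_left ?_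
    generalize hM : (c * (1 + rowSquare Z) - 2 * d * realPairing e Z - (1 - rowSquare Z)) / 2 = M
    generalize hL : c * realPairing e Z - d * (1 + rowSquare Z) / 2 = L
    generalize hf : boostFactor e c d Z = f at h0
    rw [Complex.ofReal_neg]
    field_simp
    rw [← hf, ← hM, ← hL, boostFactor]
    linear_combination (1 + rowSquare Z) * hcd'
  have h2 : (c - 1) * ((c * realPairing e Z - d * (1 + rowSquare Z) / 2) / boostFactor e c d Z) -
      ((-d : ℝ) : ℂ) * (1 + (c * (1 + rowSquare Z) - 2 * d * realPairing e Z - (1 - rowSquare Z)) / 2 /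
        boostFactor e c d Z) / 2 =
      (boostFactor e c d Z)⁻¹ * -((c - 1) * realPairing e Z - d * (1 + rowSquare Z) / 2) := by
    generalize hM : (c * (1 + rowSquare Z) - 2 * d * realPairing e Z - (1 - rowSquare Z)) / 2 = M
    generalize hL : c * realPairing e Z - d * (1 + rowSquare Z) / 2 = L
    generalize hf : boostFactor e c d Z = f at h0
    rw [Complex.ofReal_neg]
    field_simp
    rw [← hf, ← hM, ← hL, boostFactor]
    linear_combination (2 * realPairing e Z) * hcd'
  rw [lieBoost, h1, inv_inv, hl, hs, h2]
  rw [lieBoost]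
  rw [mul_smul, ← smul_add, smul_smul, mul_inv_cancel₀ h0, one_smul, add_assoc, ← add_smul,
    add_neg_cancel, zero_smul, add_zero]

end LieBall

/-! ### Transitivity on the Lie ball; the fourth series as a homogeneous base -/

section LieBallBase

open ClassicalSeries

variable {n : ℕ} {e : Fin n → ℝ} {c d : ℝ} {A Z : Matrix (Fin 1) (Fin n) ℂ}

theorem differentiable_realPairing (e : Fin n → ℝ) : Differentiable ℂ (realPairing e) := by
  unfold realPairing
  exact .fun_sum fun j _ => (differentiable_matrix_entry 0 j).const_mul _

theorem differentiable_boostFactor (e : Fin n → ℝ) (c d : ℝ) :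
    Differentiable ℂ (boostFactor e c d) := by
  have h1 := differentiable_rowSquare (n := n)
  have h2 := differentiable_realPairing e
  have h3 : Differentiable ℂ fun Z : Matrix (Fin 1) (Fin n) ℂ =>
      ((1 - rowSquare Z) + (c * (1 + rowSquare Z) - 2 * d * realPairing e Z)) * (2 : ℂ)⁻¹ :=
    ((h1.const_sub _).add (((h1.const_add _).const_mul _).sub (h2.const_mul _))).mul_const _
  simp only [← div_eq_mul_inv] at h3
  exact h3

theorem differentiableOn_lieBoost (he : ∑ j, e j ^ 2 = 1) (hc : 0 < c) (hcd : c ^ 2 - d ^ 2 = 1) :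
    DifferentiableOn ℂ (lieBoost e c d) (lieBall n) := by
  have h1 := differentiable_rowSquare (n := n)
  have h2 := differentiable_realPairing e
  have h3 : Differentiable ℂ fun Z : Matrix (Fin 1) (Fin n) ℂ =>
      (c - 1) * realPairing e Z - d * (1 + rowSquare Z) * (2 : ℂ)⁻¹ :=
    (h2.const_mul _).sub (((h1.const_add _).const_mul _).mul_const _)
  simp only [← div_eq_mul_inv] at h3
  exact ((differentiable_boostFactor e c d).differentiableOn.inv fun Z hZ =>
    boostFactor_ne_zero he hc hcd hZ).smul
      (differentiable_id.add (h3.smul_const (realRow e))).differentiableOn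

theorem holomorphicEquivOn_lieBoost (he : ∑ j, e j ^ 2 = 1) (hc : 0 < c)
    (hcd : c ^ 2 - d ^ 2 = 1) :
    HolomorphicEquivOn (lieBoost e c d) (lieBoost e c (-d)) (lieBall n) (lieBall n) where
  differentiableOn := differentiableOn_lieBoost he hc hcd
  continuousOn := (differentiableOn_lieBoost he hc (by simpa using hcd)).continuousOn
  mapsTo _ hZ := lieBoost_mem he hc hcd hZ
  mapsTo_inv _ hZ := lieBoost_mem he hc (by simpa using hcd) hZ
  leftInvOn _ hZ := lieBoost_neg_lieBoost he hcd (boostFactor_ne_zero he hc hcd hZ)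
  rightInvOn Z hZ := by
    have h0 := boostFactor_ne_zero he hc (d := -d) (by simpa using hcd) hZ
    have := lieBoost_neg_lieBoost he (by simpa using hcd) h0
    rwa [neg_neg] at this

theorem smul_mem_lieBall (hZ : Z ∈ lieBall n) {t : ℝ} (ht0 : 0 ≤ t) (ht1 : t ≤ 1) :
    (t : ℂ) • Z ∈ lieBall n := by
  obtain ⟨h1, h2⟩ := hZ
  have ht2 : t ^ 2 ≤ 1 := by nlinarith
  have h3 := norm_rowSquare_le Z
  have h4 : ‖rowSquare ((t : ℂ) • Z)‖ = t ^ 2 * ‖rowSquare Z‖ := by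
    rw [rowSquare_smul, norm_mul, norm_pow, Complex.norm_real, Real.norm_of_nonneg ht0]
  refine ⟨?_, ?_⟩
  · rw [rowNorm, h4, sum_norm_smul, Complex.norm_real, Real.norm_of_nonneg ht0]
    rw [rowNorm] at h1
    generalize ∑ j, ‖Z 0 j‖ ^ 2 = x at *
    have h5 := norm_nonneg (rowSquare Z)
    generalize ‖rowSquare Z‖ = s at *
    have h6 : 0 ≤ 2 * x - (1 + t ^ 2) * s ^ 2 := by nlinarith
    nlinarith [mul_nonneg (sub_nonneg.2 ht2) h6]
  · rw [h4]
    nlinarith [norm_nonneg (rowSquare Z)]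

theorem zero_mem_lieBall : (0 : Matrix (Fin 1) (Fin n) ℂ) ∈ lieBall n := by
  simp [lieBall, rowNorm, rowSquare]

theorem exists_log_lieBoost (he : ∑ j, e j ^ 2 = 1) (hc : 0 < c) (hcd : c ^ 2 - d ^ 2 = 1) :
    ∃ h : Matrix (Fin 1) (Fin n) ℂ → ℂ, DifferentiableOn ℂ h (lieBall n) ∧
      ∀ Z ∈ lieBall n, rowNorm (lieBoost e c d Z) = rowNorm Z * Real.exp (h Z).re := by
  obtain ⟨q, hq, hqe⟩ := exists_holomorphic_log isOpen_lieBall zero_mem_lieBall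
    (fun Z hZ t ht0 ht1 => smul_mem_lieBall hZ ht0 ht1)
    (differentiable_boostFactor e c d).differentiableOn fun Z hZ => boostFactor_ne_zero he hc hcd hZ
  refine ⟨fun Z => -2 * q Z, hq.const_mul _, fun Z hZ => ?_⟩
  have h0 := boostFactor_ne_zero he hc hcd hZ
  rw [← rowNorm_lieBoost he hcd h0, ← hqe Z hZ, Complex.norm_exp, ← Real.exp_nat_mul, mul_assoc,
    ← Real.exp_add]
  simp

/-- An automorphism of the Lie ball with a holomorphic automorphy factor. -/
def IsLieAutomorphism (φ ψ : Matrix (Fin 1) (Fin n) ℂ → Matrix (Fin 1) (Fin n) ℂ) : Prop :=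
  HolomorphicEquivOn φ ψ (lieBall n) (lieBall n) ∧
    ∃ h : Matrix (Fin 1) (Fin n) ℂ → ℂ, DifferentiableOn ℂ h (lieBall n) ∧
      ∀ Z ∈ lieBall n, rowNorm (φ Z) = rowNorm Z * Real.exp (h Z).re

theorem IsLieAutomorphism.trans {φ ψ φ' ψ' : Matrix (Fin 1) (Fin n) ℂ → Matrix (Fin 1) (Fin n) ℂ}
    (h : IsLieAutomorphism φ ψ) (h' : IsLieAutomorphism φ' ψ') :
    IsLieAutomorphism (φ' ∘ φ) (ψ ∘ ψ') := by
  obtain ⟨hφ, j, hj, hjN⟩ := h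
  obtain ⟨hφ', j', hj', hjN'⟩ := h'
  refine ⟨hφ.trans hφ', fun Z => j Z + j' (φ Z),
    hj.add (hj'.comp hφ.differentiableOn hφ.mapsTo), fun Z hZ => ?_⟩
  rw [Function.comp_apply, hjN' _ (hφ.mapsTo hZ), hjN Z hZ, Complex.add_re, Real.exp_add, mul_assoc]

theorem isLieAutomorphism_smul {u : ℂ} (hu : ‖u‖ = 1) :
    IsLieAutomorphism (n := n) (fun Z => u • Z) (fun Z => u⁻¹ • Z) := by
  have hu0 : u ≠ 0 := norm_ne_zero_iff.1 (by rw [hu]; exact one_ne_zero)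
  have hN : ∀ v : ℂ, ‖v‖ = 1 → ∀ Z : Matrix (Fin 1) (Fin n) ℂ, rowNorm (v • Z) = rowNorm Z := by
    intro v hv Z
    rw [rowNorm, rowSquare_smul, sum_norm_smul, norm_mul, norm_pow, hv, rowNorm]
    simp
  have hm : ∀ v : ℂ, ‖v‖ = 1 → ∀ Z ∈ lieBall n, v • Z ∈ lieBall n := by
    intro v hv Z hZ
    refine ⟨(hN v hv Z).symm ▸ hZ.1, ?_⟩
    rw [rowSquare_smul, norm_mul, norm_pow, hv, one_pow, one_mul]
    exact hZ.2
  refine ⟨⟨differentiable_id.const_smul u |>.differentiableOn, by fun_prop, hm u hu,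
    hm _ (by rw [norm_inv, hu, inv_one]), fun Z _ => ?_, fun Z _ => ?_⟩, fun _ => 0,
    differentiableOn_const _, fun Z _ => ?_⟩
  · simp [smul_smul, hu0]
  · simp [smul_smul, hu0]
  · simp [hN u hu]

theorem isLieAutomorphism_id : IsLieAutomorphism (n := n) id id :=
  ⟨.refl _, fun _ => 0, differentiableOn_const _, fun Z _ => by simp⟩

theorem rowSquare_re (Z : Matrix (Fin 1) (Fin n) ℂ) :
    (rowSquare Z).re = ∑ j, (Z 0 j).re ^ 2 - ∑ j, (Z 0 j).im ^ 2 := by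
  rw [rowSquare, Complex.re_sum, ← Finset.sum_sub_distrib]
  exact Finset.sum_congr rfl fun j _ => by rw [sq, Complex.mul_re]; ring

theorem rowSquare_im (Z : Matrix (Fin 1) (Fin n) ℂ) :
    (rowSquare Z).im = 2 * ∑ j, (Z 0 j).re * (Z 0 j).im := by
  rw [rowSquare, Complex.im_sum, Finset.mul_sum]
  exact Finset.sum_congr rfl fun j _ => by rw [sq, Complex.mul_im]; ring

/-- A point with real `Z Zᵗ` is moved by a boost to a multiple of its imaginary part. -/
theorem exists_boost_to_imaginary (hA : A ∈ lieBall n) (hs : (rowSquare A).im = 0) :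
    ∃ φ ψ, IsLieAutomorphism (n := n) φ ψ ∧
      ∃ t : ℝ, ∀ j, φ A 0 j = Complex.I * ((t * (A 0 j).im : ℝ) : ℂ) := by
  set p := √(∑ j, (A 0 j).re ^ 2) with hp
  have hp2 : p ^ 2 = ∑ j, (A 0 j).re ^ 2 := Real.sq_sqrt (Finset.sum_nonneg fun _ _ => sq_nonneg _)
  rcases (Real.sqrt_nonneg (∑ j, (A 0 j).re ^ 2)).eq_or_lt with h0 | h0
  · refine ⟨id, id, isLieAutomorphism_id, 1, fun j => ?_⟩
    rw [← hp] at h0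
    rw [← h0, zero_pow two_ne_zero, eq_comm,
      Finset.sum_eq_zero_iff_of_nonneg fun _ _ => sq_nonneg _] at hp2
    have h1 : (A 0 j).re = 0 := pow_eq_zero_iff two_ne_zero |>.1 (hp2 j (Finset.mem_univ _))
    apply Complex.ext <;> simp [h1]
  rw [← hp] at h0
  set s := (rowSquare A).re with hs_def
  have hsc : rowSquare A = (s : ℂ) := Complex.ext rfl (by simpa using hs)
  have hs1 : |s| < 1 := by
    have := hA.2
    rw [hsc, Complex.norm_real, Real.norm_eq_abs] at this
    linarith
  have hs2 := (abs_lt.1 hs1).1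
  have hN : 0 < (1 + s) ^ 2 - 4 * p ^ 2 := by
    have h1 := hA.1
    have h2 : ∑ j, ‖A 0 j‖ ^ 2 = ∑ j, (A 0 j).re ^ 2 + ∑ j, (A 0 j).im ^ 2 := by
      rw [← Finset.sum_add_distrib]
      refine Finset.sum_congr rfl fun j _ => ?_
      rw [← Complex.normSq_eq_norm_sq, Complex.normSq_apply]; ring
    have h3 := rowSquare_re A
    rw [rowNorm, h2, hsc, Complex.norm_real, Real.norm_eq_abs, sq_abs] at h1
    rw [hp2]
    linarith
  -- For real `s` the radicand is `N(A)`. The hyperbolic cosine `(1 + s) / D` and sine `2p / D` are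
  -- chosen so that the boost annihilates the component `p` along the real part.
  set D := √((1 + s) ^ 2 - 4 * p ^ 2) with hD
  have hD0 : 0 < D := Real.sqrt_pos.2 hN
  have hD2 : D ^ 2 = (1 + s) ^ 2 - 4 * p ^ 2 := Real.sq_sqrt hN.le
  let e : Fin n → ℝ := fun j => (A 0 j).re / p
  have he : ∑ j, e j ^ 2 = 1 := by
    simp only [e, div_pow]
    rw [← Finset.sum_div, ← hp2, div_self (by positivity)]
  have hc : 0 < (1 + s) / D := div_pos (by linarith) hD0
  have hcd : ((1 + s) / D) ^ 2 - (2 * p / D) ^ 2 = 1 := by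
    field_simp
    linarith
  -- Since `s` is real, the real and imaginary parts of `A` are orthogonal, so the pairing has no
  -- imaginary part.
  have hl : realPairing e A = p := by
    refine Complex.ext ?_ ?_
    · simp only [realPairing, Complex.re_sum, Complex.re_ofReal_mul, Complex.ofReal_re, e]
      rw [← mul_left_inj' h0.ne', ← sq, hp2, Finset.sum_mul]
      refine Finset.sum_congr rfl fun j _ => ?_
      field_simp
    · simp only [realPairing, Complex.im_sum, Complex.im_ofReal_mul, Complex.ofReal_im, e]
      rw [rowSquare_im] at hs
      have h1 : ∑ j, (A 0 j).re * (A 0 j).im = 0 := by linarith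
      rw [← mul_left_inj' h0.ne', zero_mul, ← h1, Finset.sum_mul]
      refine Finset.sum_congr rfl fun j _ => ?_
      field_simp
  refine ⟨_, _, ⟨holomorphicEquivOn_lieBoost he hc hcd, exists_log_lieBoost he hc hcd⟩,
    (((1 - s) + ((1 + s) / D * (1 + s) - 2 * (2 * p / D) * p)) / 2)⁻¹, fun j => ?_⟩
  have hf : boostFactor e ((1 + s) / D) (2 * p / D) A =
      (((1 - s) + ((1 + s) / D * (1 + s) - 2 * (2 * p / D) * p)) / 2 : ℝ) := by
    rw [boostFactor, hl, hsc]
    push_cast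
    ring
  have hκ : (((1 + s) / D : ℝ) - 1 : ℂ) * realPairing e A -
      ((2 * p / D : ℝ) : ℂ) * (1 + rowSquare A) / 2 = ((-p : ℝ) : ℂ) := by
    rw [hl, hsc]
    push_cast
    ring
  rw [lieBoost, hf, hκ]
  simp only [Matrix.smul_apply, Matrix.add_apply, realRow, Matrix.of_apply, smul_eq_mul,
    ← Complex.ofReal_mul, ← Complex.ofReal_inv, e]
  rw [neg_mul, mul_div_cancel₀ _ h0.ne']
  generalize (((1 - s) + ((1 + s) / D * (1 + s) - 2 * (2 * p / D) * p)) / 2)⁻¹ = t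
  apply Complex.ext <;> simp

/-- A rotation makes `Z Zᵗ` real, and a boost then removes the real part. Multiplication by `-i`
makes the result real, so a second boost leaves a multiple of a zero imaginary part. -/
theorem exists_lieAutomorphism_map_zero (hA : A ∈ lieBall n) :
    ∃ φ ψ, IsLieAutomorphism (n := n) φ ψ ∧ φ A = 0 := by
  obtain ⟨u, hu, hus⟩ : ∃ u : ℂ, ‖u‖ = 1 ∧ (u ^ 2 * rowSquare A).im = 0 := by
    refine ⟨Complex.exp (((-(rowSquare A).arg / 2 : ℝ) : ℂ) * Complex.I),
      Complex.norm_exp_ofReal_mul_I _, ?_⟩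
    nth_rewrite 2 [← Complex.norm_mul_exp_arg_mul_I (rowSquare A)]
    rw [← Complex.exp_nat_mul, mul_left_comm, ← Complex.exp_add]
    have : ((2 : ℕ) : ℂ) * (((-(rowSquare A).arg / 2 : ℝ) : ℂ) * Complex.I) +
        (rowSquare A).arg * Complex.I = 0 := by
      push_cast; ring
    rw [this, Complex.exp_zero, mul_one, Complex.ofReal_im]
  have h1 := isLieAutomorphism_smul (n := n) hu
  obtain ⟨φ₂, ψ₂, h2, t, ht⟩ := exists_boost_to_imaginary (h1.1.mapsTo hA)
    (by rw [rowSquare_smul]; exact hus)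
  have h3 := (h1.trans h2).trans (isLieAutomorphism_smul (n := n) (u := -Complex.I) (by simp))
  have him : ∀ j, (-Complex.I • φ₂ (u • A)) 0 j = ((t * ((u • A) 0 j).im : ℝ) : ℂ) := by
    intro j
    rw [Matrix.smul_apply, ht, smul_eq_mul, ← mul_assoc, neg_mul, Complex.I_mul_I, neg_neg, one_mul]
  obtain ⟨φ₄, ψ₄, h4, t', ht'⟩ := exists_boost_to_imaginary (h3.1.mapsTo hA) (by
    rw [rowSquare_im]
    refine mul_eq_zero_of_right _ (Finset.sum_eq_zero fun j _ => mul_eq_zero_of_right _ ?_)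
    exact (congrArg Complex.im (him j)).trans (Complex.ofReal_im _))
  refine ⟨_, _, h3.trans h4, Matrix.ext fun i j => ?_⟩
  rw [Subsingleton.elim i 0]
  refine (ht' j).trans ?_
  have : ((((fun Z => -Complex.I • Z) ∘ φ₂ ∘ fun Z => u • Z) A) 0 j).im = 0 :=
    (congrArg Complex.im (him j)).trans (Complex.ofReal_im _)
  rw [this]
  simp

/-- An isometry onto an inner product space, followed by the homothety that multiplies squared norms
by `c`. -/
noncomputable def scaledEquiv {V X : Type*} [NormedAddCommGroup V] [NormedSpace ℂ V]
    [NormedAddCommGroup X] [InnerProductSpace ℂ X] (i : V ≃ₗᵢ[ℂ] X) {c : ℝ} (hc : 0 < c) :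
    V ≃L[ℂ] X :=
  i.toContinuousLinearEquiv.trans (ContinuousLinearEquiv.smulLeft
    (Units.mk0 ((√c : ℝ) : ℂ) (Complex.ofReal_ne_zero.2 (Real.sqrt_pos.2 hc).ne')))

theorem norm_scaledEquiv_sq {V X : Type*} [NormedAddCommGroup V] [NormedSpace ℂ V]
    [NormedAddCommGroup X] [InnerProductSpace ℂ X] (i : V ≃ₗᵢ[ℂ] X) {c : ℝ} (hc : 0 < c) (v : V) :
    ‖scaledEquiv i hc v‖ ^ 2 = c * ‖v‖ ^ 2 := by
  change ‖((√c : ℝ) : ℂ) • i v‖ ^ 2 = _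
  rw [norm_smul, mul_pow, Complex.norm_real, Real.norm_eq_abs, sq_abs, Real.sq_sqrt hc.le,
    i.norm_map]

/-- Squared norms are doubled because `N = 1 - 2‖Z‖² + |Z Zᵗ|²`. The upper bound is `N ≤ (1 - ‖Z‖²)²
≤ exp (-2‖Z‖²)`, from `|Z Zᵗ| ≤ ‖Z‖²`. -/
theorem homogeneousBase_lieBall :
    HomogeneousBase (X := euclideanImage ⊤)
      {Z : (⊤ : Submodule ℂ (Matrix (Fin 1) (Fin n) ℂ)) | Z.1 ∈ lieBall n}
      (fun Z => rowNorm Z.1) (scaledEquiv (matrixEuclideanEquiv ⊤) two_pos) where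
  isOpen := isOpen_lieBall.preimage continuous_subtype_val
  isBounded := by
    refine isBounded_iff_forall_norm_le.2 ⟨1, fun Z hZ => ?_⟩
    have h1 := sum_lt_one hZ
    rw [← norm_sq_row] at h1
    exact ((sq_lt_one_iff₀ (norm_nonneg _)).1 h1).le
  zero_mem := zero_mem_lieBall
  smul_mem Z hZ t ht0 ht1 := smul_mem_lieBall hZ ht0 ht1
  continuous := continuous_rowNorm.comp continuous_subtype_val
  pos Z hZ := hZ.1
  mem_of_closure Z hZ hN := by
    refine ⟨hN, lt_of_le_of_ne ?_ fun h => ?_⟩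
    · have hc := (continuous_rowSquare (n := n)).norm.comp
        (continuous_subtype_val (p := (· ∈ (⊤ : Submodule ℂ (Matrix (Fin 1) (Fin n) ℂ)))))
      have : Z ∈ {Z : (⊤ : Submodule ℂ (Matrix (Fin 1) (Fin n) ℂ)) | 0 ≤ 1 - ‖rowSquare Z.1‖} :=
        closure_minimal (fun Z' hZ' => hZ'.2.le) (isClosed_le continuous_const
          (continuous_const.sub hc)) hZ
      exact this
    -- If `|Z Zᵗ| = 1`, then `‖Z‖² ≥ 1` and `N = 2 - 2‖Z‖² ≤ 0`.
    · have h1 := norm_rowSquare_le Z.1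
      rw [rowNorm] at hN
      have h2 : ‖rowSquare Z.1‖ = 1 := by linarith
      rw [h2] at hN h1
      linarith
  lower Z hZ := by
    rw [norm_scaledEquiv_sq, Submodule.coe_norm, norm_sq_row, rowNorm]
    nlinarith [sq_nonneg ‖rowSquare Z.1‖]
  upper Z hZ := by
    rw [norm_scaledEquiv_sq, Submodule.coe_norm, norm_sq_row, rowNorm]
    have h1 := norm_rowSquare_le Z.1
    have h2 := sum_lt_one hZ
    generalize ∑ j, ‖Z.1 0 j‖ ^ 2 = x at *
    have h3 := Real.add_one_le_exp (-x)
    have h4 : Real.exp (-(2 * x)) = Real.exp (-x) ^ 2 := by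
      rw [← Real.exp_nat_mul]; congr 1; push_cast; ring
    rw [h4]
    have h5 : (1 - x) ^ 2 ≤ Real.exp (-x) ^ 2 := pow_le_pow_left₀ (by linarith) (by linarith) 2
    nlinarith [norm_nonneg (rowSquare Z.1)]
  transitive A hA := by
    obtain ⟨φ, ψ, ⟨h, q, hq, hqN⟩, hφA⟩ := exists_lieAutomorphism_map_zero hA
    obtain ⟨φ', ψ', h', hφe⟩ := h.exists_restrict ⊤ (fun _ _ _ => trivial) fun _ _ _ => trivial
    refine ⟨φ', ψ', fun Z => q Z.1, h', ?_, ?_, fun Z hZ => ?_⟩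
    · exact Subtype.ext ((hφe A hA).trans hφA)
    · exact hq.comp (Submodule.subtypeL _).differentiable.differentiableOn fun Z hZ => hZ
    · simp only [hφe Z hZ]
      exact hqN Z.1 hZ

end LieBallBase

/-! ### All four series, and the theorem -/

/-- `Ω` and `N` form a homogeneous base for suitable Euclidean coordinates. -/
def IsHomogeneousBase {V : Type*} [NormedAddCommGroup V] [NormedSpace ℂ V] (Ω : Set V)
    (N : V → ℝ) : Prop :=
  ∃ (X : Type) (_ : NormedAddCommGroup X) (_ : InnerProductSpace ℂ X) (ℓ : V ≃L[ℂ] X),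
    HomogeneousBase Ω N ℓ

theorem isHomogeneousBase (T : ClassicalSeries) : IsHomogeneousBase T.domain T.genericNorm := by
  cases T with
  | I r s hr hrs => exact ⟨_, _, _, _, homogeneousBase_all (a := r) (b := s)⟩
  | II p hp =>
    exact ⟨_, _, _, _, homogeneousBase_transpose (ClassicalSeries.symmetricMatrices p) (σ := 1)
      (by simp) (by simp) fun Z => by rw [one_smul]; rfl⟩
  | III q hq =>
    exact ⟨_, _, _, _, homogeneousBase_transpose (ClassicalSeries.skewSymmetricMatrices q)
      (σ := -1) (by simp) (by simp) fun Z => by rw [neg_one_smul]; rfl⟩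
  | IV n hn => exact ⟨_, _, _, _, homogeneousBase_lieBall (n := n)⟩

theorem mainTheorem3 (T : ClassicalSeries) (m : ℕ) (hm : 1 ≤ m) (k : ℝ) (hk : 0 < k) :
    (∀ P₀ ∈ frontier (cartanHartogs T m k), P₀.2 ≠ 0 →
      Tendsto (squeezingFunction (cartanHartogs T m k)) (𝓝[cartanHartogs T m k] P₀) (𝓝 1)) ∧
    IsHomogeneousRegular (cartanHartogs T m k) := by
  obtain ⟨X, _, _, ℓ, h⟩ := isHomogeneousBase T
  have : Nonempty (Fin m) := ⟨⟨0, hm⟩⟩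
  exact ⟨fun P₀ hP₀ hW₀ => h.tendsto_squeezingFunction hk hP₀ hW₀, h.isHomogeneousRegular hk⟩
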